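/- Let $K$ be a commutative locally compact hypergroup (in the sense of Dunkl, Jewett and Spector) with convolution $\omega(x,y)=\delta_x*\delta_y$, involution $x\mapsto\tilde x$ and Haar measure $\mu$. Translations are $T_xf(y)=\int_K f\,d\omega(x,y)$, and $UC(K)$ is the space of all $f\in C^b(K)$ for which $x\mapsto T_xf$ is continuous from $K$ to $(C^b(K),\|\cdot\|_\infty)$. Let $\widehat K$ be the set of nonzero $\alpha\in C^b(K)$ with $\int_K\alpha\,d\omega(x,y)=\alpha(x)\alpha(y)$ and $\alpha(\tilde x)=\overline{\alpha(x)}$ for all $x,y\in K$. For $\alpha\in\widehat K$ and $X=UC(K)$ or $X=L^\infty(K)$, an $\alpha$-mean on $X$ is a bounded linear functional $m$ on $X$ with $m(\alpha)=1$ and $m(T_xf)=\alpha(x)m(f)$ for all $f\in X$, $x\in K$. The space $X$ is called $\alpha$-amenable if it has an $\alpha$-mean, and $K$ is called $\alpha$-amenable if $L^\infty(K)$ is. Theorem. Let $\alpha\in\widehat K$. Then $UC(K)$ is $\alpha$-amenable if and only if $K$ is $\alpha$-amenable. Moreover, there are $g\in L^1(K)$ with $\widehat g(\alpha)=\int_K\overline{\alpha}\,g\,d\mu=1$,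 and for every $\alpha$-mean $m$ on $UC(K)$ and every such $g$ the following holds: $\varphi*g\in UC(K)$ for all $\varphi\in L^\infty(K)$, where $(\varphi*g)(x)=\int_K\varphi(y)\,T_{\tilde y}g(x)\,d\mu(y)$, and $\varphi\mapsto m(\varphi*g)$ is an $\alpha$-mean on $L^\infty(K)$ whose restriction to $UC(K)$ is $m$. -/

import Mathlib

open MeasureTheory Topology
open scoped ENNReal NNReal BoundedContinuousFunction ComplexConjugate

/-- A (locally compact) hypergroup in the sense of Dunkl, Jewett and Spector. The underlying space is
supposed to be locally compact and Hausdorff wherever the notion is used. `conv x y` is the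
convolution `ω(x, y) = δ_x * δ_y` of the point masses at `x` and `y`; the topology on
`ProbabilityMeasure K` is the weak topology and the topology on the compact subsets of `K` is the
Michael (Vietoris) topology. -/
class Hypergroup (K : Type*) [TopologicalSpace K] [MeasurableSpace K] [BorelSpace K] where
  conv : K → K → ProbabilityMeasure K
  one : K
  invol : K → K
  regular_conv : ∀ x y, (conv x y : Measure K).Regular
  isCompact_support : ∀ x y, IsCompact (conv x y : Measure K).support
  continuous_conv : Continuous fun p : K × K => conv p.1 p.2
  continuous_support :
    Continuous[inferInstance, TopologicalSpace.vietoris K]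
      fun p : K × K => (conv p.1 p.2 : Measure K).support
  one_conv : ∀ x, (conv one x : Measure K) = Measure.dirac x
  conv_one : ∀ x, (conv x one : Measure K) = Measure.dirac x
  /-- `δ_x * (δ_y * δ_z) = (δ_x * δ_y) * δ_z`, tested against bounded continuous functions. -/
  conv_assoc : ∀ (x y z : K) (f : K →ᵇ ℂ),
    ∫ t, (∫ s, f s ∂(conv x t : Measure K)) ∂(conv y z : Measure K) =
      ∫ t, (∫ s, f s ∂(conv t z : Measure K)) ∂(conv x y : Measure K)
  continuous_invol : Continuous invol
  invol_invol : ∀ x, invol (invol x) = x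
  map_invol_conv : ∀ x y,
    (conv x y : Measure K).map invol = (conv (invol y) (invol x) : Measure K)
  one_mem_support_iff : ∀ x y, one ∈ (conv x y : Measure K).support ↔ y = invol x

/-- A commutative hypergroup: `ω(x, y) = ω(y, x)`. -/
class CommHypergroup (K : Type*) [TopologicalSpace K] [MeasurableSpace K] [BorelSpace K]
    extends Hypergroup K where
  conv_comm : ∀ x y : K, conv x y = conv y x

namespace Hypergroup

noncomputable section

variable {K : Type*} [TopologicalSpace K] [MeasurableSpace K] [BorelSpace K]

/-- A Haar measure on `K`: a nonzero positive Radon measure that satisfies `∫ T_x f dμ = ∫ f dμ` for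
all nonnegative `f ∈ C_c(K)` and all `x ∈ K`. Radon measures are normalized to be inner regular on
all Borel sets, so that "null" and "locally null" agree for Borel sets also if `K` is not
`σ`-compact, and `L^∞(μ)` is the usual space of (locally) essentially bounded functions. -/
class IsHaar [Hypergroup K] (μ : Measure K) : Prop
    extends IsFiniteMeasureOnCompacts μ, μ.InnerRegular where
  ne_zero : μ ≠ 0
  lintegral_translate : ∀ (x : K) (f : K → ℝ≥0), Continuous f → HasCompactSupport f →
    ∫⁻ y, (∫⁻ t, (f t : ℝ≥0∞) ∂(conv x y : Measure K)) ∂μ = ∫⁻ y, (f y : ℝ≥0∞) ∂μ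

section translation

variable [Hypergroup K]

lemma integrable_conv (f : K →ᵇ ℂ) (x y : K) : Integrable f (conv x y : Measure K) :=
  f.integrable _

/-- The translation `T_x f (y) = ∫ f dω(x, y)` on `C^b(K)`. -/
def translate (x : K) (f : K →ᵇ ℂ) : K →ᵇ ℂ :=
  BoundedContinuousFunction.ofNormedAddCommGroup (fun y => ∫ t, f t ∂(conv x y : Measure K))
    (continuous_iff_continuousAt.2 fun y =>
      (ProbabilityMeasure.tendsto_iff_forall_integral_rclike_tendsto ℂ).1
        ((continuous_conv.comp (Continuous.prodMk_right x)).tendsto y) f)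
    ‖f‖ (fun _ => f.norm_integral_le_norm _)

lemma translate_apply (x : K) (f : K →ᵇ ℂ) (y : K) :
    translate x f y = ∫ t, f t ∂(conv x y : Measure K) := rfl

lemma translate_add (x : K) (f g : K →ᵇ ℂ) :
    translate x (f + g) = translate x f + translate x g := by
  ext y
  simpa [translate_apply] using integral_add (integrable_conv f x y) (integrable_conv g x y)

lemma translate_smul (x : K) (c : ℂ) (f : K →ᵇ ℂ) :
    translate x (c • f) = c • translate x f := by
  ext y
  simp [translate_apply, integral_const_mul]

lemma norm_translate_le (x : K) (f : K →ᵇ ℂ) : ‖translate x f‖ ≤ ‖f‖ :=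
  BoundedContinuousFunction.norm_ofNormedAddCommGroup_le _ (norm_nonneg f) _

variable (K) in
/-- `UC(K)`: the bounded continuous functions `f` for which `x ↦ T_x f` is continuous from `K` to
`C^b(K)` with the uniform norm. -/
def UC : Submodule ℂ (K →ᵇ ℂ) where
  carrier := {f | Continuous fun x => translate x f}
  zero_mem' := by
    have h : (fun x : K => translate x (0 : K →ᵇ ℂ)) = fun _ => 0 := by
      ext x y
      simp [translate_apply]
    simpa [h] using (continuous_const : Continuous fun _ : K => (0 : K →ᵇ ℂ))
  add_mem' := by
    intro f g hf hg
    change Continuous fun x => translate x (f + g)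
    simp only [translate_add]
    exact Continuous.add (f := fun x => translate x f) (g := fun x => translate x g) hf hg
  smul_mem' := by
    intro c f hf
    change Continuous fun x => translate x (c • f)
    simp only [translate_smul]
    exact Continuous.const_smul (g := fun x => translate x f) hf c

variable (K) in
/-- The dual `K̂`: the nonzero bounded continuous functions with `ω(x, y)(α) = α(x) α(y)` and
`α(x̃) = conj (α(x))`. -/
def Dual : Set (K →ᵇ ℂ) :=
  {α | α ≠ 0 ∧ (∀ x y, ∫ t, α t ∂(conv x y : Measure K) = α x * α y) ∧
    ∀ x, α (invol x) = conj (α x)}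

lemma dual_subset_UC {α : K →ᵇ ℂ} (hα : α ∈ Dual K) : α ∈ UC K := by
  have h : (fun x => translate x α) = fun x => α x • α := by
    ext x y
    simpa [translate_apply] using hα.2.1 x y
  change Continuous fun x => translate x α
  rw [h]
  exact α.continuous.smul continuous_const

end translation

lemma translate_mem_UC [CommHypergroup K] (x : K) {f : K →ᵇ ℂ} (hf : f ∈ UC K) :
    translate x f ∈ UC K := by
  have hcomm : ∀ z, translate z (translate x f) = translate x (translate z f) := by
    intro z
    ext y
    have h1 := conv_assoc x z y f
    have h2 := conv_assoc z x y f
    rw [CommHypergroup.conv_comm z x] at h2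
    exact h1.trans h2.symm
  change Continuous fun z => translate z (translate x f)
  simp only [hcomm]
  have hlip : LipschitzWith 1 (translate x : (K →ᵇ ℂ) → K →ᵇ ℂ) :=
    LipschitzWith.of_dist_le_mul fun g h => by
      have : translate x g - translate x h = translate x (g - h) := by
        have := translate_add x (g - h) h
        rw [sub_add_cancel] at this
        rw [this, add_sub_cancel_right]
      rw [dist_eq_norm, this, dist_eq_norm, NNReal.coe_one, one_mul]
      exact norm_translate_le x _
  exact hlip.continuous.comp hf

/-- The translation on `UC(K)`. -/
def translateUC [CommHypergroup K] (x : K) (f : UC K) : UC K :=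
  ⟨translate x f, translate_mem_UC x f.2⟩

section Linfty

variable [T2Space K] [LocallyCompactSpace K] [Hypergroup K]

/-- The part of `ω(x, y)` inside an open set is seen by functions in `C_c(K)`. -/
lemma exists_compactlySupported (x : K) {U : Set K} (hU : IsOpen U) {c : ℝ≥0∞} {y : K}
    (hc : c < (conv x y : Measure K) U) :
    ∃ f : K → ℝ≥0, Continuous f ∧ HasCompactSupport f ∧ (∀ t, (f t : ℝ≥0∞) ≤ U.indicator 1 t) ∧
      ∀ᶠ z in 𝓝 y, c < ∫⁻ t, (f t : ℝ≥0∞) ∂(conv x z : Measure K) := by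
  have := regular_conv x y
  obtain ⟨C, hCU, hC, hcC⟩ := hU.exists_lt_isCompact hc
  obtain ⟨f, h1, h0, hs, hf⟩ := exists_continuous_one_zero_of_isCompact hC hU.isClosed_compl
    (Set.disjoint_compl_right_iff_subset.2 hCU)
  let g : K → ℝ≥0 := fun t => (f t).toNNReal
  have hg : Continuous g := continuous_real_toNNReal.comp f.continuous
  have hg1 : ∀ t, g t ≤ 1 := fun t => by simpa [g] using (hf t).2
  have hgC : ∀ t ∈ C, g t = 1 := fun t ht => by simp [g, h1 ht]
  refine ⟨g, hg, hs.comp_left (g := Real.toNNReal) (by simp), fun t => ?_, ?_⟩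
  · by_cases ht : t ∈ U
    · simpa [ht] using hg1 t
    · simp [ht, g, h0 (show t ∈ Uᶜ from ht)]
  · let F : K →ᵇ ℝ≥0 := BoundedContinuousFunction.mkOfBound ⟨g, hg⟩ 1 fun s t => by
      have hs := hg1 s
      have ht := hg1 t
      rw [NNReal.dist_eq, abs_le]
      simp only [ContinuousMap.coe_mk]
      constructor <;> linarith [(g s).coe_nonneg, (g t).coe_nonneg, NNReal.coe_le_coe.2 hs,
        NNReal.coe_le_coe.2 ht, NNReal.coe_one]
    have hcont : Filter.Tendsto (fun z => ∫⁻ t, (F t : ℝ≥0∞) ∂(conv x z : Measure K)) (𝓝 y)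
        (𝓝 (∫⁻ t, (F t : ℝ≥0∞) ∂(conv x y : Measure K))) :=
      (ProbabilityMeasure.tendsto_iff_forall_lintegral_tendsto).1
        ((continuous_conv.comp (Continuous.prodMk_right x)).tendsto y) F
    refine hcont.eventually (lt_mem_nhds (hcC.trans_le ?_))
    calc (conv x y : Measure K) C = ∫⁻ t, C.indicator 1 t ∂(conv x y : Measure K) :=
          (lintegral_indicator_one hC.measurableSet).symm
      _ ≤ _ := lintegral_mono fun t => by
          by_cases ht : t ∈ C
          · have : F t = 1 := hgC t ht
            simp [ht, this]
          · simp [ht]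

lemma isOpen_lt_conv (x : K) {U : Set K} (hU : IsOpen U) (c : ℝ≥0∞) :
    IsOpen {y | c < (conv x y : Measure K) U} := by
  refine isOpen_iff_mem_nhds.2 fun y hy => ?_
  obtain ⟨f, hf, hfs, hfU, h⟩ := exists_compactlySupported x hU hy
  filter_upwards [h] with z hz
  refine lt_of_lt_of_le hz ?_
  calc _ ≤ ∫⁻ t, U.indicator 1 t ∂(conv x z : Measure K) := lintegral_mono hfU
    _ = _ := lintegral_indicator_one hU.measurableSet

/-- The kernel `y ↦ ω(x, y)`. -/
def convKernel (x : K) : ProbabilityTheory.Kernel K K where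
  toFun y := conv x y
  measurable' :=
    .measure_of_isPiSystem_of_isProbabilityMeasure (BorelSpace.measurable_eq (α := K))
      isPiSystem_isOpen fun _ hU => measurable_of_Ioi fun c => (isOpen_lt_conv x hU c).measurableSet

instance (x : K) : ProbabilityTheory.IsMarkovKernel (convKernel x) :=
  ⟨fun y => inferInstanceAs (IsProbabilityMeasure (conv x y : Measure K))⟩

lemma mul_measure_lt_conv_le (μ : Measure K) [IsHaar μ] (x : K) {U : Set K} (hU : IsOpen U)
    (c : ℝ≥0∞) : c * μ {y | c < (conv x y : Measure K) U} ≤ μ U := by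
  rw [(isOpen_lt_conv x hU c).measurableSet.measure_eq_iSup_isCompact]
  simp only [ENNReal.mul_iSup]
  refine iSup_le fun D => iSup_le fun hD => iSup_le fun hDc => ?_
  obtain ⟨f, hf, hfs, hfU, h⟩ : ∃ f : K → ℝ≥0, Continuous f ∧ HasCompactSupport f ∧
      (∀ t, (f t : ℝ≥0∞) ≤ U.indicator 1 t) ∧
      ∀ z ∈ D, c < ∫⁻ t, (f t : ℝ≥0∞) ∂(conv x z : Measure K) := by
    refine hDc.induction_on (p := fun D => ∃ f : K → ℝ≥0, Continuous f ∧ HasCompactSupport f ∧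
      (∀ t, (f t : ℝ≥0∞) ≤ U.indicator 1 t) ∧
      ∀ z ∈ D, c < ∫⁻ t, (f t : ℝ≥0∞) ∂(conv x z : Measure K)) ?_ ?_ ?_ ?_
    · exact ⟨0, continuous_zero, HasCompactSupport.zero, by simp, by simp⟩
    · rintro s t hst ⟨f, h1, h2, h3, h4⟩
      exact ⟨f, h1, h2, h3, fun z hz => h4 z (hst hz)⟩
    · rintro s t ⟨f, h1, h2, h3, h4⟩ ⟨g, k1, k2, k3, k4⟩
      refine ⟨f ⊔ g, h1.sup k1, ?_, fun t => ?_, ?_⟩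
      · refine (h2.union k2).of_isClosed_subset (isClosed_tsupport _) ?_
        refine closure_minimal (fun t ht => ?_) ((isClosed_tsupport _).union (isClosed_tsupport _))
        by_contra hn
        simp only [Set.mem_union, not_or] at hn
        exact ht (by simp [image_eq_zero_of_notMem_tsupport hn.1,
          image_eq_zero_of_notMem_tsupport hn.2])
      · rcases le_total (f t) (g t) with hfg | hfg
        · simpa [hfg] using k3 t
        · simpa [hfg] using h3 t
      · rintro z (hz | hz)
        · exact (h4 z hz).trans_le (lintegral_mono fun t => by
            exact ENNReal.coe_le_coe.2 (le_sup_left : f t ≤ f t ⊔ g t))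
        · exact (k4 z hz).trans_le (lintegral_mono fun t => by
            exact ENNReal.coe_le_coe.2 (le_sup_right : g t ≤ f t ⊔ g t))
    · intro y hy
      obtain ⟨f, h1, h2, h3, h4⟩ := exists_compactlySupported x hU (hD hy)
      exact ⟨_, mem_nhdsWithin_of_mem_nhds h4, f, h1, h2, h3, fun z hz => hz⟩
  calc c * μ D = ∫⁻ _ in D, c ∂μ := by simp
    _ ≤ ∫⁻ z in D, (∫⁻ t, (f t : ℝ≥0∞) ∂(conv x z : Measure K)) ∂μ :=
        setLIntegral_mono' hDc.measurableSet fun z hz => (h z hz).le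
    _ ≤ ∫⁻ z, (∫⁻ t, (f t : ℝ≥0∞) ∂(conv x z : Measure K)) ∂μ := setLIntegral_le_lintegral _ _
    _ = ∫⁻ t, (f t : ℝ≥0∞) ∂μ := IsHaar.lintegral_translate x f hf hfs
    _ ≤ ∫⁻ t, U.indicator 1 t ∂μ := lintegral_mono hfU
    _ = μ U := lintegral_indicator_one hU.measurableSet

/-- Supports of `ω(x, y)`, with `y` in a compact set, stay in a relatively compact open set. -/
lemma exists_isOpen_support_subset (x : K) {C : Set K} (hC : IsCompact C) :
    ∃ W : Set K, IsOpen W ∧ IsCompact (closure W) ∧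
      ∀ y ∈ C, (conv x y : Measure K).support ⊆ W := by
  refine hC.induction_on (p := fun C => ∃ W : Set K, IsOpen W ∧ IsCompact (closure W) ∧
      ∀ y ∈ C, (conv x y : Measure K).support ⊆ W) ?_ ?_ ?_ ?_
  · exact ⟨∅, isOpen_empty, by simp, by simp⟩
  · rintro s t hst ⟨W, h1, h2, h3⟩
    exact ⟨W, h1, h2, fun y hy => h3 y (hst hy)⟩
  · rintro s t ⟨W, h1, h2, h3⟩ ⟨V, k1, k2, k3⟩
    refine ⟨W ∪ V, h1.union k1, by rw [closure_union]; exact h2.union k2, ?_⟩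
    rintro y (hy | hy)
    · exact (h3 y hy).trans Set.subset_union_left
    · exact (k3 y hy).trans Set.subset_union_right
  · intro y _
    obtain ⟨W, hW, hsub, hWc⟩ :=
      exists_isOpen_superset_and_isCompact_closure (isCompact_support x y)
    have hopen : IsOpen {p : K × K | (conv p.1 p.2 : Measure K).support ⊆ W} :=
      @IsOpen.preimage _ _ _ (TopologicalSpace.vietoris K) _ continuous_support _
        hW.powerset_vietoris
    have hmem : {z | (conv x z : Measure K).support ⊆ W} ∈ 𝓝 y :=
      (hopen.preimage (Continuous.prodMk_right x)).mem_nhds hsub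
    exact ⟨_, mem_nhdsWithin_of_mem_nhds hmem, W, hW, hWc, fun z hz => hz⟩

/-- Translations respect `μ`-null sets. -/
lemma ae_conv_eq_zero (μ : Measure K) [IsHaar μ] (x : K) {N : Set K} (hN : MeasurableSet N)
    (h0 : μ N = 0) : ∀ᵐ y ∂μ, (conv x y : Measure K) N = 0 := by
  have hmeas : Measurable fun y => (conv x y : Measure K) N :=
    (convKernel x).measurable_coe hN
  have hc : ∀ c : ℝ≥0∞, c ≠ 0 → c ≠ ∞ → μ {y | c < (conv x y : Measure K) N} = 0 := by
    intro c hc0 hct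
    rw [(measurableSet_lt measurable_const hmeas).measure_eq_iSup_isCompact]
    simp only [ENNReal.iSup_eq_zero]
    intro C hCN hC
    obtain ⟨W, hW, hWc, hsub⟩ := exists_isOpen_support_subset x hC
    have hWfin : μ W ≠ ∞ := ((measure_mono subset_closure).trans_lt hWc.measure_lt_top).ne
    have : IsFiniteMeasure (μ.restrict W) := ⟨by simpa using hWfin.lt_top⟩
    have hle : ∀ ε : ℝ≥0∞, ε ≠ 0 → c * μ C ≤ ε := by
      intro ε hε
      have hr : μ.restrict W N = 0 := Measure.restrict_apply_eq_zero' hW.measurableSet |>.2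
        (measure_mono_null Set.inter_subset_left h0)
      obtain ⟨V, hNV, hV, hVε⟩ := N.exists_isOpen_lt_of_lt (μ := μ.restrict W) ε
        (by rw [hr]; exact pos_iff_ne_zero.2 hε)
      rw [Measure.restrict_apply hV.measurableSet] at hVε
      refine le_trans ?_ hVε.le
      refine le_trans ?_ (mul_measure_lt_conv_le μ x (hV.inter hW) c)
      gcongr
      intro y hy
      refine lt_of_lt_of_le (b := (conv x y : Measure K) N) (hCN hy) ?_
      have := regular_conv x y
      have hae : ∀ᵐ t ∂(conv x y : Measure K), t ∈ W := by
        filter_upwards [Measure.support_mem_ae_of_regular (μ := (conv x y : Measure K))] with t ht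
        exact hsub y hy ht
      exact measure_mono_ae (by filter_upwards [hae] with t ht htN using ⟨hNV htN, ht⟩)
    have : c * μ C = 0 := by
      by_contra hne
      obtain ⟨ε, h1, h2⟩ := exists_between (pos_iff_ne_zero.2 hne)
      exact absurd (hle ε h1.ne') (not_le.2 h2)
    exact (mul_eq_zero.1 this).resolve_left hc0
  rw [ae_iff]
  refine measure_mono_null (t := ⋃ n : ℕ, {y | ((n : ℝ≥0∞) + 1)⁻¹ < (conv x y : Measure K) N})
    (fun y hy => ?_) (measure_iUnion_null fun n => hc _ (by simp) (by simp))
  obtain ⟨n, hn⟩ := ENNReal.exists_inv_nat_lt (show (conv x y : Measure K) N ≠ 0 from hy)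
  exact Set.mem_iUnion.2 ⟨n, lt_of_le_of_lt (ENNReal.inv_le_inv.2 le_self_add) hn⟩

lemma ae_conv_of_ae (μ : Measure K) [IsHaar μ] (x : K) {p : K → Prop} (hp : ∀ᵐ t ∂μ, p t) :
    ∀ᵐ y ∂μ, ∀ᵐ t ∂(conv x y : Measure K), p t := by
  filter_upwards [ae_conv_eq_zero μ x (measurableSet_toMeasurable μ {t | ¬ p t})
    (by rw [measure_toMeasurable]; exact hp)] with y hy
  exact measure_mono_null (subset_toMeasurable μ _) hy

lemma memLp_translate (μ : Measure K) [IsHaar μ] (x : K) (φ : Lp ℂ ∞ μ) :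
    MemLp (fun y => ∫ t, φ t ∂(conv x y : Measure K)) ∞ μ := by
  have hφ : ∀ᵐ t ∂μ, ‖φ t‖ ≤ ‖φ‖ := by
    have h := ae_le_eLpNormEssSup (f := φ) (μ := μ)
    rw [← eLpNorm_exponent_top, ← Lp.enorm_def] at h
    filter_upwards [h] with t ht using by simpa [enorm_le_iff_norm_le] using ht
  refine memLp_top_of_bound (C := ‖φ‖) ?_ ?_
  · exact ((Lp.stronglyMeasurable φ).integral_kernel (κ := convKernel x)).aestronglyMeasurable
  · filter_upwards [ae_conv_of_ae μ x hφ] with y hy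
    simpa using norm_integral_le_of_norm_le_const hy

/-- The translation `T_x φ (y) = ∫ φ dω(x, y)` on `L^∞(K)`. -/
def translateLinfty (μ : Measure K) [IsHaar μ] (x : K) (φ : Lp ℂ ∞ μ) : Lp ℂ ∞ μ :=
  (memLp_translate μ x φ).toLp _

/-- `T_x φ` does not depend on the representative of `φ`. -/
lemma translateLinfty_toLp (μ : Measure K) [IsHaar μ] (x : K) {f : K → ℂ} (hf : MemLp f ∞ μ) :
    translateLinfty μ x (hf.toLp f) =ᵐ[μ] fun y => ∫ t, f t ∂(conv x y : Measure K) := by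
  refine (MemLp.coeFn_toLp _).trans ?_
  filter_upwards [ae_conv_of_ae μ x hf.coeFn_toLp] with y hy
  exact integral_congr_ae hy

end Linfty

/-- The class in `L^∞(K)` of a bounded continuous function. -/
def toLinfty (μ : Measure K) (f : K →ᵇ ℂ) : Lp ℂ ∞ μ :=
  (memLp_top_of_bound f.continuous.aestronglyMeasurable ‖f‖
    (Filter.Eventually.of_forall f.norm_coe_le_norm)).toLp f

/-- An `α`-mean on a space `X` of functions on `K`, where `T` is the translation on `X` and `a ∈ X`
is `α`, seen as an element of `X`: a bounded linear functional `M` on `X` with `M(α) = 1` and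
`M(T_x f) = α(x) M(f)`. -/
structure IsAlphaMean {X : Type*} [NormedAddCommGroup X] [NormedSpace ℂ X] (α : K → ℂ) (a : X)
    (T : K → X → X) (M : X →L[ℂ] ℂ) : Prop where
  map_char : M a = 1
  map_translate : ∀ (x : K) (f : X), M (T x f) = α x * M f

/-- `M` is an `α`-mean on `UC(K)`. -/
def IsAlphaMeanUC [CommHypergroup K] {α : K →ᵇ ℂ} (hα : α ∈ Dual K) (M : UC K →L[ℂ] ℂ) : Prop :=
  IsAlphaMean α ⟨α, dual_subset_UC hα⟩ translateUC M

/-- `M` is an `α`-mean on `L^∞(K)`. -/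
def IsAlphaMeanLinfty [T2Space K] [LocallyCompactSpace K] [CommHypergroup K] (μ : Measure K)
    [IsHaar μ] (α : K →ᵇ ℂ) (M : Lp ℂ ∞ μ →L[ℂ] ℂ) : Prop :=
  IsAlphaMean α (toLinfty μ α) (translateLinfty μ) M

/-- `UC(K)` is `α`-amenable. -/
def UCAmenable [CommHypergroup K] {α : K →ᵇ ℂ} (hα : α ∈ Dual K) : Prop :=
  ∃ M : UC K →L[ℂ] ℂ, IsAlphaMeanUC hα M

/-- `K` is `α`-amenable, that is, `L^∞(K)` is `α`-amenable. -/
def Amenable [T2Space K] [LocallyCompactSpace K] [CommHypergroup K] (μ : Measure K)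
    [IsHaar μ] (α : K →ᵇ ℂ) : Prop :=
  ∃ M : Lp ℂ ∞ μ →L[ℂ] ℂ, IsAlphaMeanLinfty μ α M

/-- The Fourier transform `ĝ(α) = ∫ conj (α) g dμ` of `g ∈ L^1(K)`. -/
def fourier (μ : Measure K) (g : Lp ℂ 1 μ) (α : K →ᵇ ℂ) : ℂ :=
  ∫ x, conj (α x) * g x ∂μ

/-- The convolution `(φ * g)(x) = ∫ φ(y) T_{ỹ} g(x) dμ(y)` of `φ ∈ L^∞(K)` and `g ∈ L^1(K)`. -/
def convolution [Hypergroup K] (μ : Measure K) (φ : Lp ℂ ∞ μ) (g : Lp ℂ 1 μ) (x : K) : ℂ :=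
  ∫ y, φ y * ∫ t, g t ∂(conv (invol y) x : Measure K) ∂μ

end

end Hypergroup

/-!
An `α`-mean `m` on `UC(K)` is extended by `φ ↦ m(φ * g)`. Convolution intertwines the translations,
so this functional has the required covariance. For `f ∈ UC(K)`, `f * g` is the average
`∫ g(s) T_s̃ f dμ(s)` of the translates of `f`, so that `m(f * g) = ĝ(α) m(f)`; in particular the
extension takes the value `1` at `α` and restricts to `m` when `ĝ(α) = 1`.

Both facts rest on the adjoint relation `∫ (T_x f) g dμ = ∫ f (T_x̃ g) dμ`. It follows from Fubini's
theorem for averages of `f` and `g` by a symmetric approximate unit. As `μ` need not be `σ`-finite,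
Fubini's theorem is used for functions with compact support only, and identities pass to `L^1(K)` by
density and to `L^∞(K)` by multiplication with the indicator of a compact set.
-/

section Radon

variable {X : Type*} [TopologicalSpace X] [MeasurableSpace X] {μ ν : Measure X}

lemma lintegral_eq_iSup_compacts (μ : Measure X) [μ.InnerRegular] {f : X → ℝ≥0∞}
    (hf : AEMeasurable f μ) :
    ∫⁻ t, f t ∂μ = ⨆ D : TopologicalSpace.Compacts X, ∫⁻ t in D, f t ∂μ := by
  suffices H : ∀ g : X → ℝ≥0∞, Measurable g →
      ∫⁻ t, g t ∂μ = ⨆ D : TopologicalSpace.Compacts X, ∫⁻ t in D, g t ∂μ by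
    rw [lintegral_congr_ae hf.ae_eq_mk, H _ hf.measurable_mk]
    exact iSup_congr fun D => lintegral_congr_ae (ae_restrict_of_ae hf.ae_eq_mk.symm)
  intro g hg
  refine Measurable.ennreal_induction (motive := fun g =>
    ∫⁻ t, g t ∂μ = ⨆ D : TopologicalSpace.Compacts X, ∫⁻ t in D, g t ∂μ) ?_ ?_ ?_ hg
  · intro c s hs
    simp only [lintegral_indicator_const hs, ← ENNReal.mul_iSup, Measure.restrict_apply hs]
    congr 1
    refine le_antisymm ?_ (iSup_le fun D => measure_mono Set.inter_subset_left)
    rw [hs.measure_eq_iSup_isCompact]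
    exact iSup₂_le fun C hCs => iSup_le fun hC =>
      le_iSup_of_le ⟨C, hC⟩ (measure_mono (Set.subset_inter hCs subset_rfl))
  · intro g h _ hg _ ihg ihh
    simp only [Pi.add_apply, lintegral_add_left hg, ihg, ihh]
    exact ENNReal.iSup_add_iSup_of_monotone (fun _ _ h => lintegral_mono_set h)
      fun _ _ h => lintegral_mono_set h
  · intro g hg hmono ih
    simp only [lintegral_iSup hg hmono, ih]
    exact iSup_comm

variable [BorelSpace X] [T2Space X]

lemma innerRegular_of_absolutelyContinuous [IsFiniteMeasure μ] [μ.InnerRegular]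
    [IsFiniteMeasure ν] (h : ν ≪ μ) : ν.InnerRegular := by
  refine ⟨fun B hB r hr => ?_⟩
  obtain ⟨δ, hδ, hνδ⟩ := exists_pos_setLIntegral_lt_of_measure_lt
    (Measure.lintegral_rnDeriv_lt_top ν μ).ne (tsub_pos_of_lt hr).ne'
  simp only [Measure.setLIntegral_rnDeriv h] at hνδ
  obtain ⟨C, hCB, hC, hμC⟩ := hB.exists_isCompact_sdiff_lt (measure_ne_top μ B) hδ.ne'
  have hlt : ν B - ν C < ν B - r := le_measure_sdiff.trans_lt (hνδ _ hμC)
  exact ⟨C, hCB, hC, lt_of_tsub_lt_tsub_left hlt⟩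

variable [LocallyCompactSpace X]

lemma measure_le_of_lintegral_le [μ.InnerRegular] [IsFiniteMeasureOnCompacts μ] [ν.InnerRegular]
    (h : ∀ f : X → ℝ≥0, Continuous f → HasCompactSupport f → ∫⁻ t, f t ∂ν ≤ ∫⁻ t, f t ∂μ) :
    ν ≤ μ := by
  refine Measure.le_iff.2 fun s hs => ?_
  rw [hs.measure_eq_iSup_isCompact]
  refine iSup₂_le fun C hCs => iSup_le fun hC => ?_
  refine le_trans (le_of_forall_gt fun r hr => ?_) (measure_mono hCs)
  obtain ⟨U, hCU, hU, hUr⟩ := hC.exists_isOpen_lt_of_lt r hr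
  obtain ⟨f, hf1, hf0, hfc, hf⟩ := exists_continuous_one_zero_of_isCompact hC hU.isClosed_compl
    (Set.disjoint_compl_right_iff_subset.2 hCU)
  let g : X → ℝ≥0 := fun t => (f t).toNNReal
  have hCg (t : X) : C.indicator 1 t ≤ (g t : ℝ≥0∞) := by
    by_cases ht : t ∈ C
    · simp [g, ht, hf1 ht]
    · simp [ht]
  have hgU (t : X) : (g t : ℝ≥0∞) ≤ U.indicator 1 t :=
    Set.le_indicator_apply (fun _ => by simpa [g] using (hf t).2) fun ht => by simp [g, hf0 ht]
  calc ν C = ∫⁻ t, C.indicator 1 t ∂ν := (lintegral_indicator_one hC.measurableSet).symm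
    _ ≤ ∫⁻ t, g t ∂ν := lintegral_mono hCg
    _ ≤ ∫⁻ t, g t ∂μ := h g (continuous_real_toNNReal.comp f.continuous)
        (hfc.comp_left Real.toNNReal_zero)
    _ ≤ ∫⁻ t, U.indicator 1 t ∂μ := lintegral_mono hgU
    _ = μ U := lintegral_indicator_one hU.measurableSet
    _ < r := hUr

lemma measure_eq_of_lintegral_eq [μ.InnerRegular] [IsFiniteMeasureOnCompacts μ] [ν.InnerRegular]
    (h : ∀ f : X → ℝ≥0, Continuous f → HasCompactSupport f → ∫⁻ t, f t ∂ν = ∫⁻ t, f t ∂μ) :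
    ν = μ := by
  have hle : ν ≤ μ := measure_le_of_lintegral_le fun f hf hfc => (h f hf hfc).le
  have : IsFiniteMeasureOnCompacts ν := ⟨fun _ hC => (hle _).trans_lt hC.measure_lt_top⟩
  exact hle.antisymm (measure_le_of_lintegral_le fun f hf hfc => (h f hf hfc).ge)

lemma exists_hasCompactSupport_lintegral_enorm_sub_indicator_le [μ.InnerRegular]
    [IsFiniteMeasureOnCompacts μ] {s : Set X} (hs : MeasurableSet s) (hμs : μ s ≠ ∞)
    {ε : ℝ≥0∞} (hε : ε ≠ 0) :
    ∃ χ : X → ℝ, Continuous χ ∧ HasCompactSupport χ ∧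
      ∫⁻ t, ‖χ t - s.indicator 1 t‖ₑ ∂μ ≤ ε := by
  have hε2 : ε / 2 ≠ 0 := (ENNReal.half_pos hε).ne'
  obtain ⟨C, hCs, hC, hCε⟩ := hs.exists_isCompact_sdiff_lt hμs hε2
  obtain ⟨U, hCU, hU, hUε⟩ := hC.exists_isOpen_lt_add (μ := μ) hε2
  obtain ⟨χ, hχ1, hχ0, hχc, hχ⟩ := exists_continuous_one_zero_of_isCompact hC hU.isClosed_compl
    (Set.disjoint_compl_right_iff_subset.2 hCU)
  refine ⟨χ, χ.continuous, hχc, ?_⟩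
  have hle (t : X) : ‖χ t - s.indicator 1 t‖ₑ ≤ (s \ C ∪ U \ C).indicator 1 t := by
    refine Set.le_indicator_apply (fun _ => ?_) fun ht => ?_
    · rw [Pi.one_apply, ← enorm_one (G := ℝ), enorm_le_iff_norm_le, norm_one]
      obtain ⟨h0, h1⟩ := hχ t
      by_cases hts : t ∈ s <;> simp only [hts, Set.indicator_of_mem, Set.indicator_of_notMem,
        not_false_eq_true, Pi.one_apply, Real.norm_eq_abs, abs_le] <;> constructor <;> linarith
    · by_cases htC : t ∈ C
      · simp [hχ1 htC, hCs htC]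
      · simp only [Set.mem_union, Set.mem_sdiff, htC, not_false_eq_true, and_true, not_or] at ht
        simp [hχ0 (show t ∈ Uᶜ from ht.2), ht.1]
  calc ∫⁻ t, ‖χ t - s.indicator 1 t‖ₑ ∂μ
    _ ≤ ∫⁻ t, (s \ C ∪ U \ C).indicator 1 t ∂μ := lintegral_mono hle
    _ = μ (s \ C ∪ U \ C) := lintegral_indicator_one
        ((hs.diff hC.measurableSet).union (hU.measurableSet.diff hC.measurableSet))
    _ ≤ μ (s \ C) + μ (U \ C) := measure_union_le _ _
    _ ≤ ε / 2 + ε / 2 := by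
        refine add_le_add hCε.le ?_
        rw [measure_sdiff hCU hC.measurableSet.nullMeasurableSet hC.measure_lt_top.ne]
        exact tsub_le_iff_left.2 hUε.le
    _ = ε := ENNReal.add_halves ε

lemma exists_hasCompactSupport_eLpNorm_one_sub_le {E : Type*} [NormedAddCommGroup E]
    [NormedSpace ℝ E] [μ.InnerRegular] [IsFiniteMeasureOnCompacts μ] {f : X → E}
    (hf : Integrable f μ) {ε : ℝ≥0∞} (hε : ε ≠ 0) :
    ∃ g : X → E, Continuous g ∧ HasCompactSupport g ∧ eLpNorm (f - g) 1 μ ≤ ε := by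
  have hind (c : E) ⦃s : Set X⦄ (hs : MeasurableSet s) (hμs : μ s < ∞) {ε : ℝ≥0∞} (hε : ε ≠ 0) :
      ∃ g : X → E, eLpNorm (g - s.indicator fun _ => c) 1 μ ≤ ε ∧
        Continuous g ∧ HasCompactSupport g := by
    obtain ⟨η, hη, hηε⟩ := ENNReal.exists_nnreal_pos_mul_lt (enorm_ne_top (x := c)) hε
    obtain ⟨χ, hχ, hχc, hle⟩ := exists_hasCompactSupport_lintegral_enorm_sub_indicator_le hs
      hμs.ne (ENNReal.coe_ne_zero.2 hη.ne')
    refine ⟨fun t => χ t • c, ?_, hχ.smul continuous_const, hχc.smul_right⟩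
    have hsub (t : X) : χ t • c - s.indicator (fun _ => c) t = (χ t - s.indicator 1 t) • c := by
      by_cases ht : t ∈ s <;> simp [ht, sub_smul]
    simp only [eLpNorm_one_eq_lintegral_enorm, Pi.sub_apply, hsub, enorm_smul]
    rw [lintegral_mul_const' _ _ enorm_ne_top]
    exact (mul_le_mul_left hle _).trans hηε.le
  obtain ⟨g, hfg, hg, hgc⟩ := MemLp.induction_dense ENNReal.one_ne_top
    (fun g : X → E => Continuous g ∧ HasCompactSupport g) hind
    (fun _ _ hg hh => ⟨hg.1.add hh.1, hg.2.add hh.2⟩)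
    (fun _ hg => (hg.1.integrable_of_hasCompactSupport hg.2).1) (memLp_one_iff_integrable.2 hf) hε
  exact ⟨g, hg, hgc, hfg⟩

end Radon

section NonnegComplex
open scoped ComplexOrder

lemma integral_pos_of_mem_support {X : Type*} [TopologicalSpace X] [MeasurableSpace X]
    {ν : Measure X} {f : X → ℂ} (hf : Continuous f) (hfi : Integrable f ν) (hf0 : ∀ t, 0 ≤ f t)
    {t : X} (ht : t ∈ ν.support) (hft : f t ≠ 0) : 0 < ∫ s, f s ∂ν := by
  have hre : 0 < ∫ s, (f s).re ∂ν := by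
    rw [integral_pos_iff_support_of_nonneg (fun s => (Complex.nonneg_iff.1 (hf0 s)).1) hfi.re]
    refine Measure.mem_support_iff_forall t |>.1 ht _ ?_
    refine (Complex.continuous_re.comp hf).isOpen_support.mem_nhds fun h => hft ?_
    exact Complex.ext h (Complex.nonneg_iff.1 (hf0 t)).2.symm
  refine (integral_nonneg hf0).lt_of_ne' fun h => hre.ne' ?_
  exact (integral_re hfi).trans (by rw [h, map_zero])

lemma exists_boundedContinuous_one_zero_of_isCompact {X : Type*} [TopologicalSpace X] [T2Space X]
    [LocallyCompactSpace X] {C U : Set X} (hC : IsCompact C) (hU : IsOpen U) (hCU : C ⊆ U) :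
    ∃ f : X →ᵇ ℂ, HasCompactSupport f ∧ (∀ t, 0 ≤ f t) ∧ Set.EqOn f 1 C ∧ Set.EqOn f 0 Uᶜ := by
  obtain ⟨f, hf1, hf0, hfc, hf⟩ := exists_continuous_one_zero_of_isCompact hC hU.isClosed_compl
    (Set.disjoint_compl_right_iff_subset.2 hCU)
  refine ⟨BoundedContinuousFunction.ofNormedAddCommGroup (fun t => ((f t : ℝ) : ℂ))
    (Complex.continuous_ofReal.comp f.continuous) 1 fun t => ?_, ?_, fun t => ?_,
    fun t ht => ?_, fun t ht => ?_⟩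
  · simpa [abs_of_nonneg (hf t).1] using (hf t).2
  · exact hfc.comp_left Complex.ofReal_zero
  · simpa using (hf t).1
  · simp [hf1 ht]
  · simp [hf0 ht]

end NonnegComplex

section Equicontinuous

variable {X E F : Type*} [TopologicalSpace X]

lemma isClosed_setOf_continuous_of_equicontinuous [TopologicalSpace E] [UniformSpace F]
    {T : X → E → F} (hT : Equicontinuous T) : IsClosed {f | Continuous fun x => T x f} := by
  simp only [continuous_iff_continuousAt, ContinuousAt, Set.ofPred_forall]
  exact isClosed_iInter fun x => hT.isClosed_setOfPred_tendsto (hT.continuous x)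

lemma isClosed_setOf_continuous_of_norm_le [SeminormedAddCommGroup E] [SeminormedAddCommGroup F]
    {T : X → E →+ F} (hT : ∀ x f, ‖T x f‖ ≤ ‖f‖) : IsClosed {f | Continuous fun x => T x f} :=
  isClosed_setOf_continuous_of_equicontinuous (T := fun x f => T x f)
    (LipschitzWith.uniformEquicontinuous _ 1 fun x =>
      AddMonoidHomClass.lipschitz_of_bound_nnnorm (T x) 1 fun f => by
        rw [one_mul]; exact hT x f).equicontinuous

end Equicontinuous

section InvariantKernel

open ProbabilityTheory

variable {Ω E : Type*} [MeasurableSpace Ω] {μ : Measure Ω} {κ : Kernel Ω Ω}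

lemma ae_ae_of_invariant (hκ : κ.Invariant μ) {p : Ω → Prop} (hp : ∀ᵐ ω ∂μ, p ω) :
    ∀ᵐ ω ∂μ, ∀ᵐ ω' ∂κ ω, p ω' :=
  Measure.ae_ae_of_ae_comp (hκ.def.symm ▸ hp)

variable [NormedAddCommGroup E]

lemma lintegral_enorm_integral_le_of_invariant [NormedSpace ℝ E] (hκ : κ.Invariant μ) {u : Ω → E}
    (hu : AEStronglyMeasurable u μ) : ∫⁻ ω, ‖∫ ω', u ω' ∂κ ω‖ₑ ∂μ ≤ ∫⁻ ω, ‖u ω‖ₑ ∂μ := calc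
  _ ≤ ∫⁻ ω, ∫⁻ ω', ‖u ω'‖ₑ ∂κ ω ∂μ := lintegral_mono fun _ => enorm_integral_le_lintegral_enorm _
  _ = ∫⁻ ω, ‖u ω‖ₑ ∂(μ.bind κ) :=
    (Measure.lintegral_bind κ.measurable.aemeasurable (hκ.def.symm ▸ hu.enorm)).symm
  _ = ∫⁻ ω, ‖u ω‖ₑ ∂μ := by rw [hκ.def]

lemma integrable_comp_const_of_invariant (hκ : κ.Invariant μ) {u : Ω → E} (hu : Integrable u μ) :
    Integrable u ((κ ∘ₖ Kernel.const Unit μ) ()) := by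
  rwa [Kernel.comp_apply, Kernel.const_apply, hκ.def]

lemma ae_integrable_of_invariant (hκ : κ.Invariant μ) {u : Ω → E} (hu : Integrable u μ) :
    ∀ᵐ ω ∂μ, Integrable u (κ ω) := by
  simpa using (integrable_comp_const_of_invariant hκ hu).ae_of_comp

variable [NormedSpace ℝ E]

lemma integrable_integral_of_invariant (hκ : κ.Invariant μ) {u : Ω → E} (hu : Integrable u μ) :
    Integrable (fun ω => ∫ ω', u ω' ∂κ ω) μ := by
  simpa using (integrable_comp_const_of_invariant hκ hu).integral_comp

lemma integral_integral_of_invariant (hκ : κ.Invariant μ) {u : Ω → E} (hu : Integrable u μ) :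
    ∫ ω, ∫ ω', u ω' ∂κ ω ∂μ = ∫ ω, u ω ∂μ := by
  have h := Kernel.integral_comp (integrable_comp_const_of_invariant hκ hu)
  rwa [Kernel.comp_apply, Kernel.const_apply, hκ.def, eq_comm] at h

end InvariantKernel

section KernelL1

open ProbabilityTheory

variable {Ω E : Type*} [MeasurableSpace Ω] {μ : Measure Ω} {κ : Kernel Ω Ω}
  [NormedAddCommGroup E] [NormedSpace ℂ E]

lemma norm_toL1_integral_le_of_invariant (hκ : κ.Invariant μ) {u : Ω → E} (hu : Integrable u μ) :
    ‖(integrable_integral_of_invariant hκ hu).toL1 _‖ ≤ ‖hu.toL1 u‖ := by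
  rw [← enorm_le_iff_norm_le, Integrable.enorm_toL1, Integrable.enorm_toL1]
  exact lintegral_enorm_integral_le_of_invariant hκ hu.1

/-- The contraction `u ↦ (ω ↦ ∫ u dκ(ω))` of `L¹(μ)` given by a kernel `κ` that leaves `μ`
invariant. -/
noncomputable def kernelL1 (hκ : κ.Invariant μ) : Lp E 1 μ →L[ℂ] Lp E 1 μ :=
  LinearMap.mkContinuous
    { toFun := fun u => (integrable_integral_of_invariant hκ (L1.integrable_coeFn u)).toL1 _
      map_add' := fun u v => by
        rw [← Integrable.toL1_add, Integrable.toL1_eq_toL1_iff]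
        filter_upwards [ae_ae_of_invariant hκ (Lp.coeFn_add u v),
          ae_integrable_of_invariant hκ (L1.integrable_coeFn u),
          ae_integrable_of_invariant hκ (L1.integrable_coeFn v)] with ω h hu hv
        exact (integral_congr_ae h).trans (integral_add hu hv)
      map_smul' := fun c u => by
        rw [RingHom.id_apply, ← Integrable.toL1_smul, Integrable.toL1_eq_toL1_iff]
        filter_upwards [ae_ae_of_invariant hκ (Lp.coeFn_smul c u)] with ω h
        exact (integral_congr_ae h).trans (integral_smul c _) } 1 fun u => by
    rw [one_mul]
    exact (norm_toL1_integral_le_of_invariant hκ (L1.integrable_coeFn u)).trans_eq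
      (by rw [Integrable.toL1_coeFn])

lemma kernelL1_toL1 (hκ : κ.Invariant μ) {u : Ω → E} (hu : Integrable u μ) :
    kernelL1 hκ (hu.toL1 u) = (integrable_integral_of_invariant hκ hu).toL1 _ := by
  refine (Integrable.toL1_eq_toL1_iff _ _
    (integrable_integral_of_invariant hκ (L1.integrable_coeFn _)) _).2 ?_
  filter_upwards [ae_ae_of_invariant hκ hu.coeFn_toL1] with ω h using integral_congr_ae h

lemma norm_kernelL1_le (hκ : κ.Invariant μ) (u : Lp E 1 μ) : ‖kernelL1 hκ u‖ ≤ ‖u‖ := by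
  rw [← Integrable.toL1_coeFn u (L1.integrable_coeFn u), kernelL1_toL1]
  exact norm_toL1_integral_le_of_invariant hκ _

end KernelL1

namespace Hypergroup

noncomputable section

section Support

variable {K : Type*} [TopologicalSpace K] [MeasurableSpace K] [BorelSpace K] [Hypergroup K]

lemma support_mem_ae_conv (x y : K) :
    ∀ᵐ t ∂(conv x y : Measure K), t ∈ (conv x y : Measure K).support := by
  have := regular_conv x y
  exact Measure.support_mem_ae_of_regular

lemma translate_eq_zero {x y : K} {f : K →ᵇ ℂ}
    (h : ∀ t ∈ (conv x y : Measure K).support, f t = 0) : translate x f y = 0 :=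
  integral_eq_zero_of_ae ((support_mem_ae_conv x y).mono h)

open scoped ComplexOrder in
lemma translate_nonneg {f : K →ᵇ ℂ} (hf : ∀ t, 0 ≤ f t) (x y : K) : 0 ≤ translate x f y :=
  integral_nonneg hf

open scoped ComplexOrder in
lemma translate_ne_zero {x y t : K} {f : K →ᵇ ℂ} (hf : ∀ t, 0 ≤ f t)
    (ht : t ∈ (conv x y : Measure K).support) (hft : f t ≠ 0) : translate x f y ≠ 0 :=
  (integral_pos_of_mem_support f.continuous (integrable_conv f x y) hf ht hft).ne'

lemma continuous_translate_apply (f : K →ᵇ ℂ) :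
    Continuous fun p : K × K => translate p.1 f p.2 :=
  continuous_iff_continuousAt.2 fun p =>
    (ProbabilityMeasure.tendsto_iff_forall_integral_rclike_tendsto ℂ).1
      (continuous_conv.tendsto p) f

lemma isOpen_support_subset {U : Set K} (hU : IsOpen U) :
    IsOpen {p : K × K | (conv p.1 p.2 : Measure K).support ⊆ U} :=
  @IsOpen.preimage _ _ _ (TopologicalSpace.vietoris K) _ continuous_support _ hU.powerset_vietoris

lemma isClosed_mem_support [RegularSpace K] :
    IsClosed {p : K × K × K | p.1 ∈ (conv p.2.1 p.2.2 : Measure K).support} := by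
  refine isOpen_compl_iff.1 (isOpen_iff_mem_nhds.2 fun ⟨t, x, y⟩ ht => ?_)
  obtain ⟨V, ⟨hV, hVc⟩, hVs⟩ := (closed_nhds_basis t).mem_iff.1
    (Measure.isClosed_support.isOpen_compl.mem_nhds ht)
  have hU : ∀ᶠ p : K × K in 𝓝 (x, y), (conv p.1 p.2 : Measure K).support ⊆ Vᶜ :=
    (isOpen_support_subset hVc.isOpen_compl).mem_nhds (Set.subset_compl_comm.1 hVs)
  filter_upwards [prod_mem_nhds hV hU] with p hp hps using hp.2 hps hp.1

lemma mem_support_invol {x y t : K} (h : t ∈ (conv x y : Measure K).support) :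
    invol t ∈ (conv (invol y) (invol x) : Measure K).support := by
  rw [Measure.mem_support_iff_forall] at h ⊢
  intro U hU
  obtain ⟨V, hVU, hV, htV⟩ := mem_nhds_iff.1 hU
  refine lt_of_lt_of_le ?_ (measure_mono hVU)
  rw [← map_invol_conv, Measure.map_apply continuous_invol.measurable hV.measurableSet]
  exact h _ ((hV.preimage continuous_invol).mem_nhds htV)

lemma support_conv_one [T2Space K] (x : K) : (conv x one : Measure K).support = {x} := by
  rw [conv_one]
  ext y
  rw [Measure.mem_support_iff_forall, Set.mem_singleton_iff]
  constructor
  · intro h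
    by_contra hne
    simpa [Measure.dirac_apply' _ (measurableSet_singleton x).compl] using
      h {x}ᶜ (isOpen_compl_singleton.mem_nhds hne)
  · rintro rfl U hU
    simp [Measure.dirac_apply_of_mem (mem_of_mem_nhds hU)]

lemma invol_one [T2Space K] : invol (one : K) = one :=
  ((one_mem_support_iff _ _).1 (by simp [support_conv_one])).symm

variable (K) in
/-- The involution as a homeomorphism. -/
def involHomeomorph : K ≃ₜ K where
  toFun := invol
  invFun := invol
  left_inv := invol_invol
  right_inv := invol_invol
  continuous_toFun := continuous_invol
  continuous_invFun := continuous_invol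

variable [LocallyCompactSpace K]

lemma exists_isCompact_support_subset {D : Set (K × K)} (hD : IsCompact D) :
    ∃ W : Set K, IsCompact W ∧ ∀ p ∈ D, (conv p.1 p.2 : Measure K).support ⊆ W := by
  obtain ⟨W, hW⟩ := hD.elim_directed_cover
    (fun W : TopologicalSpace.Compacts K =>
      {p : K × K | (conv p.1 p.2 : Measure K).support ⊆ interior W})
    (fun _ => isOpen_support_subset isOpen_interior)
    (fun p _ => Set.mem_iUnion.2 <| by
      obtain ⟨W, hW, hsub⟩ := exists_compact_superset (isCompact_support p.1 p.2)
      exact ⟨⟨W, hW⟩, hsub⟩)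
    (Monotone.directed_le fun _ _ h _ hp => hp.trans (interior_mono h))
  exact ⟨W, W.isCompact, fun p hp => (hW hp).trans interior_subset⟩

variable [T2Space K]

-- If the conclusion fails, `supp ω(s, y)` stays away from `1` for all `s ∈ supp ω(t̃, x)`, so that
-- a bump `f` at `1` satisfies `T_x T_t̃ f (y) = 0`, although `T_t̃ f (t) > 0`.
lemma mem_support_conv_symm {x y t : K} (h : t ∈ (conv x y : Measure K).support) :
    y ∈ (conv (invol x) t : Measure K).support := by
  suffices H : invol y ∈ (conv (invol t) x : Measure K).support by
    simpa [invol_invol] using mem_support_invol H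
  by_contra hy
  have hV : ∀ᶠ v in 𝓝 (one : K), ∀ s ∈ (conv (invol t) x : Measure K).support,
      v ∉ (conv s y : Measure K).support := by
    refine (isCompact_support (invol t) x).eventually_forall_of_forall_eventually fun s hs => ?_
    have hs1 : (one : K) ∉ (conv s y : Measure K).support := by
      rw [one_mem_support_iff]
      rintro rfl
      exact hy (by rwa [invol_invol])
    have hcont : Continuous fun z : K × K => (z.1, z.2, y) := by fun_prop
    exact (isClosed_mem_support.isOpen_compl.preimage hcont).mem_nhds hs1
  obtain ⟨f, -, hf, hf1, hf0⟩ := exists_boundedContinuous_one_zero_of_isCompact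
    (isCompact_singleton (x := (one : K))) isOpen_interior
    (Set.singleton_subset_iff.2 (mem_interior_iff_mem_nhds.2 hV))
  have hft : translate (invol t) f t ≠ 0 :=
    translate_ne_zero hf ((one_mem_support_iff _ _).2 (invol_invol t).symm) (by simp [hf1 rfl])
  refine translate_ne_zero (translate_nonneg hf _) h hft
    ((conv_assoc (invol t) x y f).trans (integral_eq_zero_of_ae ?_))
  filter_upwards [support_mem_ae_conv (invol t) x] with s hs
  exact translate_eq_zero fun v hv => hf0 fun hvV => interior_subset hvV s hs hv

lemma exists_isCompact_translate_eq_zero {f : K →ᵇ ℂ} (hf : HasCompactSupport f) {A : Set K}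
    (hA : IsCompact A) : ∃ W : Set K, IsCompact W ∧ ∀ x ∈ A, ∀ y ∉ W, translate x f y = 0 := by
  obtain ⟨W, hW, hsub⟩ := exists_isCompact_support_subset ((hA.image continuous_invol).prod hf)
  refine ⟨W, hW, fun x hx y hy => translate_eq_zero fun t ht => ?_⟩
  by_contra hft
  exact hy (hsub (invol x, t) ⟨Set.mem_image_of_mem _ hx, subset_tsupport _ hft⟩
    (mem_support_conv_symm ht))

lemma hasCompactSupport_translate {f : K →ᵇ ℂ} (hf : HasCompactSupport f) (x : K) :
    HasCompactSupport (translate x f) := by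
  obtain ⟨W, hW, h⟩ := exists_isCompact_translate_eq_zero hf (isCompact_singleton (x := x))
  exact HasCompactSupport.intro hW (h x rfl)

lemma mem_UC_of_hasCompactSupport {f : K →ᵇ ℂ} (hf : HasCompactSupport f) : f ∈ UC K := by
  refine continuous_iff_continuousAt.2 fun x₀ => Metric.tendsto_nhds.2 fun ε hε => ?_
  obtain ⟨A, hA, hxA⟩ := exists_compact_mem_nhds x₀
  obtain ⟨W, hW, h⟩ := exists_isCompact_translate_eq_zero hf hA
  have hnear : ∀ᶠ x in 𝓝 x₀, ∀ y ∈ W, dist (translate x f y) (translate x₀ f y) < ε / 2 := by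
    refine hW.eventually_forall_of_forall_eventually fun y _ => ?_
    have hc : Continuous fun p : K × K => dist (translate p.1 f p.2) (translate x₀ f p.2) :=
      (continuous_translate_apply f).dist ((translate x₀ f).continuous.comp continuous_snd)
    exact hc.continuousAt.eventually_lt continuousAt_const (by simpa using half_pos hε)
  filter_upwards [hnear, hxA] with x hx hxA'
  refine lt_of_le_of_lt ?_ (half_lt_self hε)
  refine (BoundedContinuousFunction.dist_le (half_pos hε).le).2 fun y => ?_
  by_cases hy : y ∈ W
  · exact (hx y hy).le
  · rw [h x hxA' y hy, h x₀ (mem_of_mem_nhds hxA) y hy, dist_self]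
    exact (half_pos hε).le

end Support

section Translation

section Hypergroup

variable {K : Type*} [TopologicalSpace K] [MeasurableSpace K] [BorelSpace K] [Hypergroup K]

/-- The translation `T_x` as a bounded operator on `C^b(K)`. -/
def translateL (x : K) : (K →ᵇ ℂ) →L[ℂ] (K →ᵇ ℂ) :=
  LinearMap.mkContinuous
    { toFun := translate x
      map_add' := translate_add x
      map_smul' := translate_smul x } 1 fun f => by simpa using norm_translate_le x f

/-- The function `x ↦ f(x̃)`. -/
def reflect (f : K →ᵇ ℂ) : K →ᵇ ℂ := f.compContinuous ⟨invol, continuous_invol⟩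

@[simp]
lemma reflect_apply (f : K →ᵇ ℂ) (x : K) : reflect f x = f (invol x) := rfl

lemma hasCompactSupport_reflect {f : K →ᵇ ℂ} (hf : HasCompactSupport f) :
    HasCompactSupport (reflect f) :=
  hf.comp_homeomorph (involHomeomorph K)

variable (K) in
lemma isClosed_UC : IsClosed (UC K : Set (K →ᵇ ℂ)) :=
  isClosed_setOf_continuous_of_norm_le (T := fun x : K => (translateL x).toAddMonoidHom)
    norm_translate_le

instance : CompleteSpace (UC K) := (isClosed_UC K).completeSpace_coe

end Hypergroup

variable {K : Type*} [TopologicalSpace K] [MeasurableSpace K] [BorelSpace K] [CommHypergroup K]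

lemma translate_apply_comm (x y : K) (f : K →ᵇ ℂ) : translate x f y = translate y f x := by
  rw [translate_apply, translate_apply, CommHypergroup.conv_comm]

lemma translate_comm (x z : K) (f : K →ᵇ ℂ) :
    translate x (translate z f) = translate z (translate x f) := by
  ext y
  refine (conv_assoc z x y f).trans ?_
  rw [CommHypergroup.conv_comm z x]
  exact (conv_assoc x z y f).symm

lemma translate_reflect (x : K) (f : K →ᵇ ℂ) :
    translate x (reflect f) = reflect (translate (invol x) f) := by
  ext y
  rw [reflect_apply, translate_apply, translate_apply, CommHypergroup.conv_comm (invol x),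
    ← map_invol_conv, integral_map continuous_invol.aemeasurable
      f.continuous.aestronglyMeasurable]
  rfl

lemma translate_invol_apply (x y : K) (f : K →ᵇ ℂ) :
    translate (invol x) f y = translate (invol y) (reflect f) x := by
  rw [translate_reflect, reflect_apply, invol_invol, translate_apply_comm]

lemma reflect_mem_UC {f : K →ᵇ ℂ} (hf : f ∈ UC K) : reflect f ∈ UC K := by
  have hcont : Continuous fun x => reflect (translate (invol x) f) :=
    (BoundedContinuousFunction.continuous_compContinuous _).comp (hf.comp continuous_invol)
  exact hcont.congr fun x => (translate_reflect x f).symm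

/-- The translation `T_x` as a bounded operator on `UC(K)`. -/
def translateUCL (x : K) : UC K →L[ℂ] UC K :=
  (translateL x).restrict fun _ hf => translate_mem_UC x hf

@[simp]
lemma translateUCL_apply (x : K) (f : UC K) : translateUCL x f = translateUC x f := rfl

lemma continuous_translateUC (f : UC K) : Continuous fun x => translateUC x f :=
  Continuous.subtype_mk f.2 _

lemma translateUC_comm (x z : K) (f : UC K) :
    translateUC x (translateUC z f) = translateUC z (translateUC x f) :=
  Subtype.ext (translate_comm x z f)

end Translation

section Concentration

variable {K : Type*} [TopologicalSpace K] [MeasurableSpace K] [BorelSpace K]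
  [T2Space K]

lemma eventually_norm_sub_le_of_mem_support_conv [Hypergroup K] {f : K →ᵇ ℂ}
    (hf : HasCompactSupport f) {ε : ℝ} (hε : 0 < ε) :
    ∀ᶠ v in 𝓝 (one : K), ∀ a ∈ tsupport f,
      ∀ b ∈ (conv a v : Measure K).support, ‖f a - f b‖ ≤ ε := by
  refine hf.isCompact.eventually_forall_of_forall_eventually
    (P := fun v a => ∀ b ∈ (conv a v : Measure K).support, ‖f a - f b‖ ≤ ε) fun a₀ _ => ?_
  have hU : IsOpen {b | ‖f b - f a₀‖ < ε / 2} :=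
    isOpen_lt (f.continuous.sub continuous_const).norm continuous_const
  have hsupp : ∀ᶠ p : K × K in 𝓝 (one, a₀),
      (conv p.2 p.1 : Measure K).support ⊆ {b | ‖f b - f a₀‖ < ε / 2} := by
    refine ((isOpen_support_subset hU).preimage continuous_swap).mem_nhds ?_
    change (conv a₀ one : Measure K).support ⊆ _
    rw [support_conv_one]
    simpa using hε
  have hnear : ∀ᶠ p : K × K in 𝓝 (one, a₀), ‖f p.2 - f a₀‖ < ε / 2 :=
    (hU.preimage continuous_snd).mem_nhds (by simpa using hε)
  filter_upwards [hsupp, hnear] with p hsupp hnear b hb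
  have hba : ‖f a₀ - f b‖ < ε / 2 := norm_sub_rev (f b) _ ▸ hsupp hb
  linarith [norm_sub_le_norm_sub_add_norm_sub (f p.2) (f a₀) (f b)]

lemma eventually_norm_sub_le_of_mem_support_conv_invol [LocallyCompactSpace K] [CommHypergroup K]
    {f : K →ᵇ ℂ} (hf : HasCompactSupport f) {ε : ℝ} (hε : 0 < ε) :
    ∀ᶠ v in 𝓝 (one : K), ∀ s y, v ∈ (conv (invol s) y : Measure K).support → ‖f s - f y‖ ≤ ε := by
  have hnear := eventually_norm_sub_le_of_mem_support_conv hf hε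
  have hnear' := (continuous_invol.tendsto' (one : K) one invol_one).eventually hnear
  filter_upwards [hnear, hnear'] with v h h' s y hv
  have hy : y ∈ (conv s v : Measure K).support := by
    simpa [invol_invol] using mem_support_conv_symm hv
  by_cases hs : s ∈ tsupport f
  · exact h s hs y hy
  by_cases hyf : y ∈ tsupport f
  · rw [norm_sub_rev]
    refine h' y hyf s ?_
    rw [CommHypergroup.conv_comm] at hy ⊢
    exact mem_support_conv_symm hy
  · simp [image_eq_zero_of_notMem_tsupport hs, image_eq_zero_of_notMem_tsupport hyf, hε.le]

end Concentration

section Invariance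

variable {K : Type*} [TopologicalSpace K] [MeasurableSpace K] [BorelSpace K]
  [T2Space K] [LocallyCompactSpace K] [Hypergroup K] (μ : Measure K) [IsHaar μ]

lemma bind_restrict_convKernel_absolutelyContinuous {x : K} {D W : Set K} (hD : MeasurableSet D)
    (hW : MeasurableSet W) (h : ∀ y ∈ D, (conv x y : Measure K).support ⊆ W) :
    (μ.restrict D).bind (convKernel x) ≪ μ.restrict W := by
  refine Measure.AbsolutelyContinuous.mk fun N hN hN0 => ?_
  rw [Measure.restrict_apply hN] at hN0
  rw [Measure.bind_apply hN (convKernel x).measurable.aemeasurable]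
  refine lintegral_eq_zero_of_ae_eq_zero ?_
  filter_upwards [ae_restrict_of_ae (ae_conv_eq_zero μ x (hN.inter hW) hN0),
    ae_restrict_mem hD] with y hy hyD
  refine measure_mono_null_ae ?_ hy
  filter_upwards [support_mem_ae_conv x y] with t ht htN using ⟨htN, h y hyD ht⟩

lemma innerRegular_bind_convKernel (x : K) : (μ.bind (convKernel x)).InnerRegular := by
  refine ⟨fun B hB r hr => ?_⟩
  rw [Measure.bind_apply hB (convKernel x).measurable.aemeasurable, lintegral_eq_iSup_compacts μ
    ((convKernel x).measurable_coe hB).aemeasurable, lt_iSup_iff] at hr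
  obtain ⟨D, hr⟩ := hr
  rw [← Measure.bind_apply hB (convKernel x).measurable.aemeasurable] at hr
  obtain ⟨W, hW, hWc, hsub⟩ := exists_isOpen_support_subset x D.isCompact
  have : IsFiniteMeasure (μ.restrict W) :=
    isFiniteMeasure_restrict.2 ((measure_mono subset_closure).trans_lt hWc.measure_lt_top).ne
  have : IsFiniteMeasure (μ.restrict (D : Set K)) :=
    isFiniteMeasure_restrict.2 D.isCompact.measure_ne_top
  have hreg : ((μ.restrict (D : Set K)).bind (convKernel x)).InnerRegular :=
    innerRegular_of_absolutelyContinuous (bind_restrict_convKernel_absolutelyContinuous μ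
      D.isCompact.measurableSet hW.measurableSet hsub)
  obtain ⟨C, hCB, hC, hrC⟩ := hreg.innerRegular hB r hr
  refine ⟨C, hCB, hC, hrC.trans_le ?_⟩
  simp only [Measure.bind_apply hC.measurableSet (convKernel x).measurable.aemeasurable]
  exact setLIntegral_le_lintegral _ _

lemma invariant_convKernel (x : K) : (convKernel x).Invariant μ := by
  have := innerRegular_bind_convKernel μ x
  refine measure_eq_of_lintegral_eq fun f hf hfc => ?_
  rw [Measure.lintegral_bind (convKernel x).measurable.aemeasurable
    hf.measurable.coe_nnreal_ennreal.aemeasurable]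
  exact IsHaar.lintegral_translate x f hf hfc

lemma isOpenPosMeasure_of_isHaar : μ.IsOpenPosMeasure := by
  refine ⟨fun U hU ⟨u, hu⟩ hμU => IsHaar.ne_zero (μ := μ) ?_⟩
  have hnull (s : K) : ∃ V ∈ 𝓝 s, μ V = 0 := by
    obtain ⟨x, hx⟩ := (support_mem_ae_conv u (invol s)).exists
    have hu_mem : u ∈ (conv x s : Measure K).support := by
      simpa [invol_invol] using mem_support_invol (mem_support_conv_symm (mem_support_invol hx))
    refine ⟨{y | 0 < (conv x y : Measure K) U}, (isOpen_lt_conv x hU 0).mem_nhds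
      ((Measure.mem_support_iff_forall u).1 hu_mem U (hU.mem_nhds hu)), ?_⟩
    simpa [ae_iff, pos_iff_ne_zero] using ae_conv_eq_zero μ x hU.measurableSet hμU
  by_contra hμ
  obtain ⟨C, hC, hne⟩ := Measure.InnerRegular.exists_isCompact_not_null.2 hμ
  refine hne (hC.measure_zero_of_nhdsWithin fun s _ => ?_)
  obtain ⟨U, hU, h⟩ := hnull s
  exact ⟨U, mem_nhdsWithin_of_mem_nhds hU, h⟩

end Invariance

section Pairing

variable {K : Type*} [MeasurableSpace K] (μ : Measure K)

/-- The duality `⟨φ, g⟩ = ∫ φ g dμ` between `L^∞(K)` and `L^1(K)`. -/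
def pairing : Lp ℂ ∞ μ →L[ℂ] Lp ℂ 1 μ →L[ℂ] ℂ :=
  (ContinuousLinearMap.mul ℂ ℂ).lpPairing μ ∞ 1

lemma pairing_apply (φ : Lp ℂ ∞ μ) (g : Lp ℂ 1 μ) : pairing μ φ g = ∫ y, φ y * g y ∂μ :=
  (ContinuousLinearMap.mul ℂ ℂ).lpPairing_eq_integral φ g

variable {μ}

lemma pairing_toL1 (φ : Lp ℂ ∞ μ) {g : K → ℂ} (hg : Integrable g μ) :
    pairing μ φ (hg.toL1 g) = ∫ y, φ y * g y ∂μ := by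
  rw [pairing_apply]
  refine integral_congr_ae ?_
  filter_upwards [hg.coeFn_toL1] with y hy using by rw [hy]

variable [TopologicalSpace K] [BorelSpace K]

variable (μ) in
/-- The inclusion `C^b(K) → L^∞(K)` as a bounded operator. -/
def toLinftyL : (K →ᵇ ℂ) →L[ℂ] Lp ℂ ∞ μ :=
  LinearMap.mkContinuous
    { toFun := toLinfty μ
      map_add' := fun _ _ => MemLp.toLp_add _ _
      map_smul' := fun c _ => MemLp.toLp_const_smul c _ } 1 fun f => by
    rw [one_mul]
    change ‖toLinfty μ f‖ ≤ ‖f‖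
    rw [toLinfty, Lp.norm_toLp]
    exact ENNReal.toReal_le_of_le_ofReal (norm_nonneg f)
      (eLpNormEssSup_le_of_ae_bound (.of_forall f.norm_coe_le_norm))

lemma pairing_toLinfty (f : K →ᵇ ℂ) (g : Lp ℂ 1 μ) :
    pairing μ (toLinfty μ f) g = ∫ y, f y * g y ∂μ := by
  rw [pairing_apply]
  refine integral_congr_ae ?_
  filter_upwards [MemLp.coeFn_toLp (μ := μ) (f := f) _] with y hy
  rw [toLinfty, hy]

lemma pairing_toLinfty_toL1 (f : K →ᵇ ℂ) {g : K → ℂ} (hg : Integrable g μ) :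
    pairing μ (toLinfty μ f) (hg.toL1 g) = ∫ y, f y * g y ∂μ := by
  rw [pairing_toLinfty]
  refine integral_congr_ae ?_
  filter_upwards [hg.coeFn_toL1] with y hy using by rw [hy]

lemma continuous_integral_mul {g : K → ℂ} (hg : Integrable g μ) :
    Continuous fun u : K →ᵇ ℂ => ∫ y, u y * g y ∂μ := by
  simp only [← pairing_toLinfty_toL1 _ hg]
  exact ((pairing μ).flip (hg.toL1 g) ∘L toLinftyL μ).continuous

variable [IsFiniteMeasureOnCompacts μ]

lemma integrable_of_hasCompactSupport {f : K →ᵇ ℂ} (hf : HasCompactSupport f) : Integrable f μ :=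
  f.continuous.integrable_of_hasCompactSupport hf

variable (μ) in
/-- The class in `L¹(K)` of a continuous function with compact support. -/
abbrev toL1 {f : K →ᵇ ℂ} (hf : HasCompactSupport f) : Lp ℂ 1 μ :=
  (integrable_of_hasCompactSupport hf).toL1 f

lemma L1_induction_hasCompactSupport [T2Space K] [LocallyCompactSpace K] [μ.InnerRegular]
    {P : Lp ℂ 1 μ → Prop} (hP : IsClosed {g | P g})
    (h : ∀ (f : K →ᵇ ℂ) (hf : HasCompactSupport f), P (toL1 μ hf)) (g : Lp ℂ 1 μ) : P g := by
  refine hP.closure_subset (EMetric.mem_closure_iff.2 fun ε hε => ?_)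
  obtain ⟨δ, hδ, hδε⟩ := exists_between hε
  obtain ⟨f, hf, hfc, hgf⟩ := exists_hasCompactSupport_eLpNorm_one_sub_le
    (L1.integrable_coeFn g) hδ.ne'
  obtain ⟨C, hC⟩ := hfc.exists_bound_of_continuous hf
  refine ⟨_, h (.ofNormedAddCommGroup f hf C hC) hfc, lt_of_le_of_lt ?_ hδε⟩
  conv_lhs => rw [← Integrable.toL1_coeFn g (L1.integrable_coeFn g)]
  exact (Lp.edist_toLp_toLp _ _ _ _).trans_le hgf

end Pairing

section WeightedMean

open scoped ComplexOrder

lemma norm_integral_smul_sub_le {Ω E : Type*} [MeasurableSpace Ω] [NormedAddCommGroup E]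
    [NormedSpace ℂ E] [CompleteSpace E] {μ : Measure Ω} {w : Ω → ℂ} {u : Ω → E}
    (hwu : Integrable (fun s => w s • u s) μ) (hw : Integrable w μ)
    (hw0 : ∀ s, 0 ≤ w s) (hw1 : ∫ s, w s ∂μ = 1) {c : E} {ε : ℝ}
    (h : ∀ s, w s ≠ 0 → ‖u s - c‖ ≤ ε) : ‖∫ s, w s • u s ∂μ - c‖ ≤ ε := by
  have hnorm : ∫ s, ‖w s‖ ∂μ = 1 := by
    have hw_eq : ∀ s, ((‖w s‖ : ℝ) : ℂ) = w s := fun s => Complex.norm_of_nonneg' (hw0 s)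
    rw [← Complex.ofReal_inj, ← integral_complex_ofReal]
    simp only [hw_eq, hw1, Complex.ofReal_one]
  calc ‖∫ s, w s • u s ∂μ - c‖ = ‖∫ s, w s • (u s - c) ∂μ‖ := by
        simp only [smul_sub]
        rw [integral_sub hwu (hw.smul_const c), integral_smul_const, hw1, one_smul]
    _ ≤ ∫ s, ‖w s‖ * ε ∂μ := by
        refine norm_integral_le_of_norm_le (hw.norm.mul_const ε) (.of_forall fun s => ?_)
        rw [norm_smul]
        by_cases hs : w s = 0
        · simp [hs]
        · exact mul_le_mul_of_nonneg_left (h s hs) (norm_nonneg _)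
    _ = ε := by rw [integral_mul_const, hnorm, one_mul]

end WeightedMean

section ApproximateUnit

open scoped ComplexOrder

variable {K : Type*} [TopologicalSpace K] [MeasurableSpace K] [BorelSpace K] [Hypergroup K]
  (μ : Measure K)

/-- A member of a symmetric approximate unit of `L¹(μ)`: a probability density in `C_c(K)` that
vanishes outside the neighborhood `V` of the identity. -/
structure IsSymmUnit (V : Set K) (k : K →ᵇ ℂ) : Prop where
  hasCompactSupport : HasCompactSupport k
  nonneg : ∀ t, 0 ≤ k t
  reflect_eq : reflect k = k
  eq_zero : ∀ t ∉ V, k t = 0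
  integral_eq_one : ∫ t, k t ∂μ = 1

lemma exists_isSymmUnit [T2Space K] [LocallyCompactSpace K] [IsHaar μ] {V : Set K}
    (hV : V ∈ 𝓝 (one : K)) : ∃ k, IsSymmUnit μ V k := by
  have := isOpenPosMeasure_of_isHaar μ
  have hV' : V ∩ invol ⁻¹' V ∈ 𝓝 (one : K) :=
    Filter.inter_mem hV (continuous_invol.tendsto' (one : K) one invol_one hV)
  obtain ⟨χ, hχc, hχ, hχ1, hχ0⟩ := exists_boundedContinuous_one_zero_of_isCompact
    (isCompact_singleton (x := (one : K))) isOpen_interior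
    (Set.singleton_subset_iff.2 (mem_interior_iff_mem_nhds.2 hV'))
  have hχ0' : ∀ t ∉ V ∩ invol ⁻¹' V, χ t = 0 := fun t ht => hχ0 fun h => ht (interior_subset h)
  have hwc : HasCompactSupport (χ + reflect χ) := hχc.add (hasCompactSupport_reflect hχc)
  have hw : ∀ t, 0 ≤ (χ + reflect χ) t := fun t => add_nonneg (hχ t) (hχ (invol t))
  have hpos : 0 < ∫ t, (χ + reflect χ) t ∂μ :=
    integral_pos_of_mem_support (t := one) (BoundedContinuousFunction.continuous _)
      (integrable_of_hasCompactSupport hwc) hw (by simp [Measure.support_eq_univ])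
      (by simp [invol_one, hχ1 rfl])
  set c := ∫ t, (χ + reflect χ) t ∂μ
  refine ⟨c⁻¹ • (χ + reflect χ), hwc.smul_left (f := fun _ => c⁻¹),
    fun t => mul_nonneg (inv_nonneg.2 hpos.le) (hw t), ?_, fun t ht => ?_, ?_⟩
  · ext t
    simp [invol_invol, add_comm]
  · have ht' : invol t ∉ V ∩ invol ⁻¹' V := fun h => ht (by simpa [invol_invol] using h.2)
    simp [hχ0' t fun h => ht h.1, hχ0' (invol t) ht']
  · simp only [BoundedContinuousFunction.coe_smul, integral_smul]
    exact inv_mul_cancel₀ hpos.ne'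

end ApproximateUnit

section Average

variable {K : Type*} [TopologicalSpace K] [MeasurableSpace K] [BorelSpace K] [CommHypergroup K]
  (μ : Measure K)

/-- The average `∫ f(s) T_{s̃} h dμ(s)` of the translates of `h ∈ UC(K)`, as an integral in `UC(K)`.
This is the convolution of `f` and `h`. -/
def average (f : K → ℂ) (h : UC K) : UC K := ∫ s, f s • translateUC (invol s) h ∂μ

variable {μ} [IsFiniteMeasureOnCompacts μ]

lemma integrable_smul_translateUC {f : K →ᵇ ℂ} (hf : HasCompactSupport f) (h : UC K) :
    Integrable (fun s => f s • translateUC (invol s) h) μ :=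
  Continuous.integrable_of_hasCompactSupport
    (f.continuous.smul ((continuous_translateUC h).comp continuous_invol)) hf.smul_right

lemma average_apply {f : K →ᵇ ℂ} (hf : HasCompactSupport f) (h : UC K) (y : K) :
    (average μ f h : K →ᵇ ℂ) y = ∫ s, f s * translate (invol s) h y ∂μ :=
  ((BoundedContinuousFunction.evalCLM ℂ y ∘L (UC K).subtypeL).integral_comp_comm
    (integrable_smul_translateUC hf h)).symm

lemma translateUC_average {f : K →ᵇ ℂ} (hf : HasCompactSupport f) (h : UC K) (x : K) :
    translateUC x (average μ f h) = average μ f (translateUC x h) := by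
  rw [← translateUCL_apply, average,
    ← (translateUCL x).integral_comp_comm (integrable_smul_translateUC hf h)]
  simp only [map_smul, translateUCL_apply, translateUC_comm x, average]

end Average

section AdjointCc

variable {K : Type*} [TopologicalSpace K] [MeasurableSpace K] [BorelSpace K] [T2Space K]

section Average

variable [CommHypergroup K] {μ : Measure K} [IsHaar μ]

lemma integral_average_mul {f g : K →ᵇ ℂ} (hf : HasCompactSupport f) (hg : HasCompactSupport g)
    (h : UC K) :
    ∫ y, (average μ f h : K →ᵇ ℂ) y * g y ∂μ =
      ∫ y, f y * (average μ g ⟨reflect h, reflect_mem_UC h.2⟩ : K →ᵇ ℂ) y ∂μ := by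
  simp only [average_apply hf, average_apply hg, ← integral_mul_const, ← integral_const_mul,
    translate_invol_apply _ _ (h : K →ᵇ ℂ)]
  rw [integral_integral_swap_of_hasCompactSupport
    (f := fun y s => f s * translate (invol y) (reflect h) s * g y)]
  · simp only [mul_comm, mul_left_comm]
  · have hT : Continuous fun p : K × K => translate (invol p.1) (reflect (h : K →ᵇ ℂ)) p.2 :=
      (continuous_translate_apply (reflect (h : K →ᵇ ℂ))).comp
        (continuous_invol.prodMap continuous_id)
    exact ((f.continuous.comp continuous_snd).mul hT).mul (g.continuous.comp continuous_fst)
  · refine HasCompactSupport.intro (hg.isCompact.prod hf.isCompact) fun p hp => ?_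
    obtain h1 | h2 := not_and_or.1 (mt Set.mem_prod.2 hp)
    · simp [Function.uncurry, image_eq_zero_of_notMem_tsupport h1]
    · simp [Function.uncurry, image_eq_zero_of_notMem_tsupport h2]

end Average

variable [LocallyCompactSpace K]

section Hypergroup

variable [Hypergroup K] {μ : Measure K} [IsHaar μ]

lemma integral_translate {f : K →ᵇ ℂ} (hf : HasCompactSupport f) (x : K) :
    ∫ y, translate x f y ∂μ = ∫ y, f y ∂μ :=
  integral_integral_of_invariant (invariant_convKernel μ x) (integrable_of_hasCompactSupport hf)

end Hypergroup

variable [CommHypergroup K] {μ : Measure K} [IsHaar μ]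

lemma norm_average_sub_le {f k : K →ᵇ ℂ} (hf : HasCompactSupport f) {V : Set K}
    (hk : IsSymmUnit μ V k) {ε : ℝ} (hε : 0 ≤ ε)
    (h : ∀ t ∈ V, ∀ s y, t ∈ (conv (invol s) y : Measure K).support → ‖f s - f y‖ ≤ ε) :
    ‖(average μ f ⟨k, mem_UC_of_hasCompactSupport hk.hasCompactSupport⟩ : K →ᵇ ℂ) - f‖ ≤ ε := by
  refine (BoundedContinuousFunction.norm_le hε).2 fun y => ?_
  have hk_comm (s : K) : translate (invol s) k y = translate (invol y) k s := by
    rw [translate_invol_apply, hk.reflect_eq]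
  have hkc := hasCompactSupport_translate hk.hasCompactSupport (invol y)
  rw [BoundedContinuousFunction.sub_apply, average_apply hf]
  simp only [hk_comm, mul_comm (f _)]
  refine norm_integral_smul_sub_le (w := translate (invol y) k) (u := f) ?_
    (integrable_of_hasCompactSupport hkc) (translate_nonneg hk.nonneg _) ?_ fun s hs => ?_
  · exact integrable_of_hasCompactSupport (f := translate (invol y) k * f) hkc.mul_right
  · rw [integral_translate hk.hasCompactSupport, hk.integral_eq_one]
  · by_contra hsy
    refine hs (hk_comm s ▸ translate_eq_zero fun t ht => hk.eq_zero t fun htV => ?_)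
    exact hsy (h t htV s y ht)

lemma exists_seq_tendsto_average {f g : K →ᵇ ℂ} (hf : HasCompactSupport f)
    (hg : HasCompactSupport g) :
    ∃ k : ℕ → UC K, (∀ n, reflect (k n : K →ᵇ ℂ) = k n) ∧
      Filter.Tendsto (fun n => (average μ f (k n) : K →ᵇ ℂ)) Filter.atTop (𝓝 f) ∧
      Filter.Tendsto (fun n => (average μ g (k n) : K →ᵇ ℂ)) Filter.atTop (𝓝 g) := by
  have hunit (n : ℕ) : ∃ k : UC K, reflect (k : K →ᵇ ℂ) = k ∧
      ‖(average μ f k : K →ᵇ ℂ) - f‖ ≤ 1 / (n + 1) ∧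
      ‖(average μ g k : K →ᵇ ℂ) - g‖ ≤ 1 / (n + 1) := by
    have hε : 0 < 1 / ((n : ℝ) + 1) := by positivity
    obtain ⟨k, hk⟩ := exists_isSymmUnit μ (Filter.inter_mem
      (eventually_norm_sub_le_of_mem_support_conv_invol hf hε)
      (eventually_norm_sub_le_of_mem_support_conv_invol hg hε))
    exact ⟨⟨k, _⟩, hk.reflect_eq, norm_average_sub_le hf hk hε.le fun t ht => ht.1,
      norm_average_sub_le hg hk hε.le fun t ht => ht.2⟩
  choose k hk hkf hkg using hunit
  exact ⟨k, hk,
    tendsto_iff_norm_sub_tendsto_zero.2 (squeeze_zero (fun _ => norm_nonneg _) hkf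
      tendsto_one_div_add_atTop_nhds_zero_nat),
    tendsto_iff_norm_sub_tendsto_zero.2 (squeeze_zero (fun _ => norm_nonneg _) hkg
      tendsto_one_div_add_atTop_nhds_zero_nat)⟩

-- For the averages of `f` and `g` by a symmetric unit the identity is a case of Fubini's theorem.
lemma integral_translate_mul {f g : K →ᵇ ℂ} (hf : HasCompactSupport f) (hg : HasCompactSupport g)
    (x : K) : ∫ y, translate x f y * g y ∂μ = ∫ y, f y * translate (invol x) g y ∂μ := by
  obtain ⟨k, hk, hkf, hkg⟩ := exists_seq_tendsto_average (μ := μ) hf hg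
  have hlim_left := ((continuous_integral_mul (integrable_of_hasCompactSupport (μ := μ) hg)).comp
    (translateL x).continuous).continuousAt.tendsto.comp hkf
  have hlim_right := ((continuous_integral_mul (integrable_of_hasCompactSupport (μ := μ) hf)).comp
    (translateL (invol x)).continuous).continuousAt.tendsto.comp hkg
  simp only [mul_comm (f _)]
  refine tendsto_nhds_unique (hlim_left.congr fun n => ?_) hlim_right
  have hreflect : (⟨reflect (translateUC x (k n)), reflect_mem_UC (translateUC x (k n)).2⟩ : UC K) =
      translateUC (invol x) (k n) := Subtype.ext <| by
    change reflect (translate x (k n)) = translate (invol x) (k n)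
    conv_rhs => rw [← hk n]
    rw [translate_reflect, invol_invol]
  have hadj := integral_average_mul (μ := μ) hf hg (translateUC x (k n))
  rw [hreflect, ← translateUC_average hf, ← translateUC_average hg] at hadj
  simp only [mul_comm (f _)] at hadj
  exact hadj

end AdjointCc

section Involution

variable {K : Type*} [TopologicalSpace K] [MeasurableSpace K] [BorelSpace K] [T2Space K]
  [LocallyCompactSpace K]

lemma integral_integral_translate_mul [Hypergroup K] (μ : Measure K) [IsHaar μ] {e : K → K}
    (he : Continuous e) {u v : K →ᵇ ℂ} (hu : HasCompactSupport u) (hv : HasCompactSupport v) :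
    ∫ x, ∫ y, translate (e y) u x * v y ∂μ ∂μ = (∫ x, u x ∂μ) * ∫ y, v y ∂μ := by
  rw [integral_integral_swap_of_hasCompactSupport (f := fun x y => translate (e y) u x * v y)]
  · simp only [integral_mul_const, integral_translate hu, integral_const_mul]
  · exact ((continuous_translate_apply u).comp ((he.comp continuous_snd).prodMk continuous_fst)).mul
      (v.continuous.comp continuous_snd)
  · obtain ⟨W, hW, hWu⟩ := exists_isCompact_translate_eq_zero hu (hv.isCompact.image he)
    refine HasCompactSupport.intro (hW.prod hv.isCompact) fun p hp => ?_
    by_cases hpv : p.2 ∈ tsupport v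
    · have hpW : p.1 ∉ W := fun hpW => hp ⟨hpW, hpv⟩
      simp [Function.uncurry, hWu _ (Set.mem_image_of_mem e hpv) _ hpW]
    · simp [Function.uncurry, image_eq_zero_of_notMem_tsupport hpv]

variable [CommHypergroup K] (μ : Measure K) [IsHaar μ]

lemma integral_reflect {g : K →ᵇ ℂ} (hg : HasCompactSupport g) :
    ∫ y, reflect g y ∂μ = ∫ y, g y ∂μ := by
  obtain ⟨f, hf⟩ := exists_isSymmUnit μ (Filter.univ_mem : Set.univ ∈ 𝓝 (one : K))
  have hfc := hf.hasCompactSupport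
  calc ∫ y, reflect g y ∂μ
      = ∫ x, ∫ y, translate (invol y) (reflect g) x * f y ∂μ ∂μ := by
        rw [integral_integral_translate_mul μ continuous_invol (hasCompactSupport_reflect hg) hfc,
          hf.integral_eq_one, mul_one]
    _ = ∫ x, ∫ y, f y * translate (invol x) g y ∂μ ∂μ := by
        simp only [translate_invol_apply _ _ g, mul_comm (f _)]
    _ = ∫ x, ∫ y, translate y f x * g y ∂μ ∂μ := by
        simp only [← integral_translate_mul hfc hg, translate_apply_comm _ _ f]
    _ = ∫ y, g y ∂μ := by
        rw [integral_integral_translate_mul μ (e := fun y => y) continuous_id hfc hg,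
          hf.integral_eq_one, one_mul]

lemma measurePreserving_invol : MeasurePreserving (invol : K → K) μ μ := by
  refine ⟨continuous_invol.measurable, ?_⟩
  have : (μ.map (invol : K → K)).InnerRegular :=
    Measure.InnerRegular.map_of_continuous continuous_invol
  refine measure_eq_of_lintegral_eq fun f hf hfc => ?_
  have hF : Continuous fun t => ((f t : ℝ) : ℂ) := by fun_prop
  have hFc : HasCompactSupport fun t => ((f t : ℝ) : ℂ) :=
    hfc.comp_left (g := fun r : ℝ≥0 => ((r : ℝ) : ℂ)) (by simp)
  obtain ⟨C, hC⟩ := hFc.exists_bound_of_continuous hF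
  have hint := integral_reflect μ (g := .ofNormedAddCommGroup _ hF C hC) hFc
  simp only [reflect_apply, BoundedContinuousFunction.coe_ofNormedAddCommGroup,
    integral_complex_ofReal, Complex.ofReal_inj] at hint
  have hfi : Integrable (fun t => (f t : ℝ)) μ :=
    (NNReal.continuous_coe.comp hf).integrable_of_hasCompactSupport
      (hfc.comp_left NNReal.coe_zero)
  have hfi' : Integrable (fun t => (f (invol t) : ℝ)) μ :=
    (NNReal.continuous_coe.comp (hf.comp continuous_invol)).integrable_of_hasCompactSupport
      ((hfc.comp_homeomorph (involHomeomorph K)).comp_left NNReal.coe_zero)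
  rw [lintegral_map hf.measurable.coe_nnreal_ennreal continuous_invol.measurable,
    lintegral_coe_eq_integral _ hfi, lintegral_coe_eq_integral _ hfi', hint]

end Involution

section IntegralTranslate

variable {K : Type*} [TopologicalSpace K] [MeasurableSpace K] [BorelSpace K] [T2Space K]
  [Hypergroup K]

lemma integrable_conv_of_continuous {E : Type*} [NormedAddCommGroup E] {F : K → E}
    (hF : Continuous F) (x z : K) : Integrable F (conv x z : Measure K) := by
  have hC := isCompact_support x z
  have h := hF.continuousOn.integrableOn_compact (μ := (conv x z : Measure K)) hC
  rwa [IntegrableOn, Measure.restrict_eq_self_of_ae_mem (support_mem_ae_conv x z)] at h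

lemma integral_translate_conv {f : K →ᵇ ℂ} (hf : f ∈ UC K) (x z : K) :
    ∫ t, translate t f ∂(conv x z : Measure K) = translate z (translate x f) := by
  ext y
  exact ((BoundedContinuousFunction.evalCLM ℂ y).integral_comp_comm
    (integrable_conv_of_continuous hf x z)).symm.trans (conv_assoc x z y f).symm

end IntegralTranslate

section RestrictL1

variable {K : Type*} [TopologicalSpace K] [MeasurableSpace K] [BorelSpace K] [T2Space K]
  (μ : Measure K) [IsFiniteMeasureOnCompacts μ] {W : Set K}

/-- The operator `φ ↦ 1_W φ` from `L^∞(K)` to `L^1(K)` for a compact set `W`. -/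
def restrictL1 (hW : IsCompact W) : Lp ℂ ∞ μ →L[ℂ] Lp ℂ 1 μ :=
  ((ContinuousLinearMap.mul ℂ ℂ).holderL μ ∞ 1 1).flip
    (indicatorConstLp 1 hW.measurableSet hW.measure_ne_top 1)

lemma coeFn_restrictL1 (hW : IsCompact W) (φ : Lp ℂ ∞ μ) :
    restrictL1 μ hW φ =ᵐ[μ] W.indicator φ := by
  filter_upwards [(ContinuousLinearMap.mul ℂ ℂ).coeFn_holder (r := 1) φ (indicatorConstLp 1
    hW.measurableSet hW.measure_ne_top 1), indicatorConstLp_coeFn (p := 1)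
    (hs := hW.measurableSet) (hμs := hW.measure_ne_top (μ := μ)) (c := (1 : ℂ))] with y hy hind
  refine hy.trans ?_
  by_cases hyW : y ∈ W <;> simp [hind, hyW]

lemma restrictL1_toLinfty (hW : IsCompact W) {f : K →ᵇ ℂ} (hf : HasCompactSupport f)
    (hfW : ∀ y ∉ W, f y = 0) : restrictL1 μ hW (toLinfty μ f) = toL1 μ hf := by
  refine Lp.ext ?_
  filter_upwards [coeFn_restrictL1 μ hW (toLinfty μ f), MemLp.coeFn_toLp (μ := μ) (f := f) _,
    (integrable_of_hasCompactSupport (μ := μ) hf).coeFn_toL1] with y hy hinfty hone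
  rw [hy, hone]
  by_cases hyW : y ∈ W
  · rw [Set.indicator_of_mem hyW, toLinfty, hinfty]
  · rw [Set.indicator_of_notMem hyW, hfW y hyW]

lemma pairing_toL1_eq_pairing_restrictL1 (hW : IsCompact W) (φ : Lp ℂ ∞ μ) {f : K →ᵇ ℂ}
    (hf : HasCompactSupport f) (hfW : ∀ y ∉ W, f y = 0) :
    pairing μ φ (toL1 μ hf) = pairing μ (toLinfty μ f) (restrictL1 μ hW φ) := by
  rw [pairing_toL1, pairing_toLinfty]
  refine integral_congr_ae ?_
  filter_upwards [coeFn_restrictL1 μ hW φ] with y hy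
  rw [hy]
  by_cases hyW : y ∈ W
  · rw [Set.indicator_of_mem hyW, mul_comm]
  · rw [hfW y hyW, mul_zero, zero_mul]

end RestrictL1

section TranslateL1

variable {K : Type*} [TopologicalSpace K] [MeasurableSpace K] [BorelSpace K] [T2Space K]
  [LocallyCompactSpace K]

section Hypergroup

variable [Hypergroup K] (μ : Measure K) [IsHaar μ]

/-- The translation `T_x g (y) = ∫ g dω(x, y)` on `L^1(K)`. -/
def translateL1 (x : K) : Lp ℂ 1 μ →L[ℂ] Lp ℂ 1 μ := kernelL1 (invariant_convKernel μ x)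

variable {μ}

lemma coeFn_translateL1 (x : K) (g : Lp ℂ 1 μ) :
    translateL1 μ x g =ᵐ[μ] fun y => ∫ t, g t ∂(conv x y : Measure K) :=
  (integrable_integral_of_invariant (invariant_convKernel μ x)
    (L1.integrable_coeFn g)).coeFn_toL1

lemma translateL1_toL1 (x : K) {f : K →ᵇ ℂ} (hf : HasCompactSupport f) :
    translateL1 μ x (toL1 μ hf) = toL1 μ (hasCompactSupport_translate hf x) :=
  kernelL1_toL1 _ _

lemma norm_translateL1_le (x : K) (g : Lp ℂ 1 μ) : ‖translateL1 μ x g‖ ≤ ‖g‖ :=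
  norm_kernelL1_le _ g

lemma continuous_translateL1 (g : Lp ℂ 1 μ) : Continuous fun x => translateL1 μ x g := by
  refine L1_induction_hasCompactSupport (isClosed_setOf_continuous_of_norm_le
    (T := fun x => (translateL1 μ x).toAddMonoidHom) norm_translateL1_le) (fun f hf => ?_) g
  refine continuous_iff_continuousAt.2 fun x₀ => ?_
  obtain ⟨A, hA, hxA⟩ := exists_compact_mem_nhds x₀
  obtain ⟨W, hW, hWf⟩ := exists_isCompact_translate_eq_zero hf hA
  have hcont : Continuous fun x => restrictL1 μ hW (toLinftyL μ (translate x f)) :=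
    (restrictL1 μ hW ∘L toLinftyL μ).continuous.comp (mem_UC_of_hasCompactSupport hf)
  refine hcont.continuousAt.congr ?_
  filter_upwards [hxA] with x hx
  exact (restrictL1_toLinfty μ hW (hasCompactSupport_translate hf x) (hWf x hx)).trans
    (translateL1_toL1 x hf).symm

lemma integral_translateL1_conv_toL1 {f : K →ᵇ ℂ} (hf : HasCompactSupport f) (x z : K) :
    ∫ t, translateL1 μ t (toL1 μ hf) ∂(conv x z : Measure K) =
      translateL1 μ z (translateL1 μ x (toL1 μ hf)) := by
  obtain ⟨W, hW, hWf⟩ := exists_isCompact_translate_eq_zero hf (isCompact_support x z)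
  have hfUC := mem_UC_of_hasCompactSupport hf
  have hfzx := hasCompactSupport_translate (hasCompactSupport_translate hf x) z
  have hV := hW.union hfzx
  have hrestrict : ∀ᵐ t ∂(conv x z : Measure K), translateL1 μ t (toL1 μ hf) =
      (restrictL1 μ hV ∘L toLinftyL μ) (translate t f) := by
    filter_upwards [support_mem_ae_conv x z] with t ht
    rw [translateL1_toL1]
    exact (restrictL1_toLinfty μ hV _ fun y hy => hWf t ht y fun h => hy (.inl h)).symm
  rw [integral_congr_ae hrestrict, ContinuousLinearMap.integral_comp_comm _
    (integrable_conv_of_continuous hfUC x z), integral_translate_conv hfUC, translateL1_toL1,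
    translateL1_toL1]
  exact restrictL1_toLinfty μ hV hfzx fun y hy =>
    image_eq_zero_of_notMem_tsupport fun h => hy (.inr h)

lemma integral_translateL1_conv (g : Lp ℂ 1 μ) (x z : K) :
    ∫ t, translateL1 μ t g ∂(conv x z : Measure K) = translateL1 μ z (translateL1 μ x g) := by
  have hint (g : Lp ℂ 1 μ) := integrable_conv_of_continuous (continuous_translateL1 g) x z
  have hlip : LipschitzWith 1 fun g : Lp ℂ 1 μ =>
      ∫ t, translateL1 μ t g ∂(conv x z : Measure K) := by
    refine .of_dist_le_mul fun g g' => ?_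
    rw [dist_eq_norm, dist_eq_norm, ← integral_sub (hint g) (hint g')]
    simp only [← map_sub]
    simpa using norm_integral_le_of_norm_le_const (μ := (conv x z : Measure K))
      (.of_forall fun t => norm_translateL1_le t (g - g'))
  exact L1_induction_hasCompactSupport (isClosed_eq hlip.continuous
    ((translateL1 μ z).continuous.comp (translateL1 μ x).continuous))
    (fun f hf => integral_translateL1_conv_toL1 hf x z) g

end Hypergroup

end TranslateL1

section Adjoint

variable {K : Type*} [TopologicalSpace K] [MeasurableSpace K] [BorelSpace K] [T2Space K]
  [LocallyCompactSpace K] [CommHypergroup K] {μ : Measure K} [IsHaar μ]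

lemma translateL1_comm (x z : K) (g : Lp ℂ 1 μ) :
    translateL1 μ x (translateL1 μ z g) = translateL1 μ z (translateL1 μ x g) := by
  rw [← integral_translateL1_conv, ← integral_translateL1_conv, CommHypergroup.conv_comm]

variable (μ) in
/-- The involution `g ↦ (y ↦ g(ỹ))` of `L^1(K)`. -/
def reflectL1 : Lp ℂ 1 μ →L[ℂ] Lp ℂ 1 μ :=
  (Lp.compMeasurePreservingₗᵢ ℂ invol (measurePreserving_invol μ)).toContinuousLinearMap

lemma coeFn_reflectL1 (g : Lp ℂ 1 μ) : reflectL1 μ g =ᵐ[μ] fun y => g (invol y) :=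
  Lp.coeFn_compMeasurePreserving g (measurePreserving_invol μ)

lemma reflectL1_toL1 {f : K →ᵇ ℂ} (hf : HasCompactSupport f) :
    reflectL1 μ (toL1 μ hf) = toL1 μ (hasCompactSupport_reflect hf) := rfl

lemma translateL1_reflectL1 (x : K) (g : Lp ℂ 1 μ) :
    translateL1 μ x (reflectL1 μ g) = reflectL1 μ (translateL1 μ (invol x) g) := by
  refine L1_induction_hasCompactSupport (isClosed_eq (translateL1 μ x ∘L reflectL1 μ).continuous
    (reflectL1 μ ∘L translateL1 μ (invol x)).continuous) (fun f hf => ?_) g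
  simp only [ContinuousLinearMap.comp_apply, reflectL1_toL1, translateL1_toL1, translate_reflect]

lemma pairing_toLinfty_translateL1 {g : K →ᵇ ℂ} (hg : HasCompactSupport g) (x : K)
    (u : Lp ℂ 1 μ) : pairing μ (toLinfty μ g) (translateL1 μ x u) =
      pairing μ (toLinfty μ (translate (invol x) g)) u := by
  refine L1_induction_hasCompactSupport (isClosed_eq
    (pairing μ (toLinfty μ g) ∘L translateL1 μ x).continuous
    (pairing μ (toLinfty μ (translate (invol x) g))).continuous) (fun f hf => ?_) u
  simp only [ContinuousLinearMap.comp_apply, translateL1_toL1, pairing_toLinfty_toL1]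
  simpa only [mul_comm] using integral_translate_mul hf hg x

lemma pairing_translateLinfty_toL1 (φ : Lp ℂ ∞ μ) {g : K →ᵇ ℂ} (hg : HasCompactSupport g)
    {W : Set K} (hW : IsCompact W) {x : K}
    (hgW : ∀ y ∈ tsupport g, (conv x y : Measure K).support ⊆ W) :
    pairing μ (translateLinfty μ x φ) (toL1 μ hg) =
      pairing μ (toLinfty μ g) (translateL1 μ x (restrictL1 μ hW φ)) := by
  rw [pairing_toL1, pairing_toLinfty]
  refine integral_congr_ae ?_
  filter_upwards [(memLp_translate μ x φ).coeFn_toLp,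
    coeFn_translateL1 x (restrictL1 μ hW φ), ae_conv_of_ae μ x (coeFn_restrictL1 μ hW φ)]
    with y hφ hy hrestrict
  rw [translateLinfty, hφ, hy, mul_comm]
  by_cases hyg : y ∈ tsupport g
  · congr 1
    refine integral_congr_ae ?_
    filter_upwards [hrestrict, support_mem_ae_conv x y] with t ht hts
    rw [ht, Set.indicator_of_mem (hgW y hyg hts)]
  · rw [image_eq_zero_of_notMem_tsupport hyg, zero_mul, zero_mul]

lemma pairing_translateLinfty (φ : Lp ℂ ∞ μ) (g : Lp ℂ 1 μ) (x : K) :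
    pairing μ (translateLinfty μ x φ) g = pairing μ φ (translateL1 μ (invol x) g) := by
  refine L1_induction_hasCompactSupport (isClosed_eq (pairing μ (translateLinfty μ x φ)).continuous
    (pairing μ φ ∘L translateL1 μ (invol x)).continuous) (fun f hf => ?_) g
  obtain ⟨V, hV, hVf⟩ := exists_isCompact_support_subset (isCompact_singleton (x := x) |>.prod hf)
  have hxf := hasCompactSupport_translate hf (invol x)
  have hW := hV.union hxf
  calc pairing μ (translateLinfty μ x φ) (toL1 μ hf)
      = pairing μ (toLinfty μ f) (translateL1 μ x (restrictL1 μ hW φ)) :=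
        pairing_translateLinfty_toL1 φ hf hW fun y hy =>
          (hVf (x, y) ⟨rfl, hy⟩).trans Set.subset_union_left
    _ = pairing μ (toLinfty μ (translate (invol x) f)) (restrictL1 μ hW φ) :=
        pairing_toLinfty_translateL1 hf x _
    _ = pairing μ φ (toL1 μ hxf) :=
        (pairing_toL1_eq_pairing_restrictL1 μ hW φ hxf fun y hy =>
          image_eq_zero_of_notMem_tsupport fun h => hy (.inr h)).symm
    _ = pairing μ φ (translateL1 μ (invol x) (toL1 μ hf)) := by rw [translateL1_toL1]

end Adjoint

section Convolution

variable {K : Type*} [TopologicalSpace K] [MeasurableSpace K] [BorelSpace K] [T2Space K]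
  [LocallyCompactSpace K] [CommHypergroup K] (μ : Measure K) [IsHaar μ]

/-- The convolution `φ * g` of `φ ∈ L^∞(K)` and `g ∈ L^1(K)`, encoded as the bounded continuous
function `z ↦ ⟨φ, R T_z g⟩`, where `R` is the involution of `L^1(K)`. -/
def convBCF (φ : Lp ℂ ∞ μ) (g : Lp ℂ 1 μ) : K →ᵇ ℂ :=
  .ofNormedAddCommGroup (fun z => pairing μ φ (reflectL1 μ (translateL1 μ z g)))
    ((pairing μ φ ∘L reflectL1 μ).continuous.comp (continuous_translateL1 g))
    (‖pairing μ φ ∘L reflectL1 μ‖ * ‖g‖) fun z =>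
      (pairing μ φ ∘L reflectL1 μ).le_opNorm_of_le (norm_translateL1_le z g)

@[simp]
lemma convBCF_apply (φ : Lp ℂ ∞ μ) (g : Lp ℂ 1 μ) (z : K) :
    convBCF μ φ g z = pairing μ φ (reflectL1 μ (translateL1 μ z g)) := rfl

lemma norm_convBCF_le (φ : Lp ℂ ∞ μ) (g : Lp ℂ 1 μ) :
    ‖convBCF μ φ g‖ ≤ ‖pairing μ‖ * ‖reflectL1 μ‖ * ‖φ‖ * ‖g‖ := by
  refine (BoundedContinuousFunction.norm_ofNormedAddCommGroup_le _
    (mul_nonneg (norm_nonneg _) (norm_nonneg g)) _).trans ?_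
  rw [mul_right_comm _ _ ‖φ‖]
  gcongr
  exact ((pairing μ φ).opNorm_comp_le _).trans
    (mul_le_mul_of_nonneg_right ((pairing μ).le_opNorm φ) (norm_nonneg _))

/-- Convolution as a bounded bilinear map. -/
def convL : Lp ℂ ∞ μ →L[ℂ] Lp ℂ 1 μ →L[ℂ] K →ᵇ ℂ :=
  LinearMap.mkContinuous₂ (LinearMap.mk₂ ℂ (convBCF μ)
    (fun φ φ' g => by ext z; simp) (fun c φ g => by ext z; simp)
    (fun φ g g' => by ext z; simp) (fun c φ g => by ext z; simp))
    (‖pairing μ‖ * ‖reflectL1 μ‖) (norm_convBCF_le μ)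

variable {μ}

lemma convL_apply (φ : Lp ℂ ∞ μ) (g : Lp ℂ 1 μ) (z : K) :
    convL μ φ g z = pairing μ φ (reflectL1 μ (translateL1 μ z g)) := rfl

lemma convolution_eq_convL (φ : Lp ℂ ∞ μ) (g : Lp ℂ 1 μ) (z : K) :
    convolution μ φ g z = convL μ φ g z := by
  rw [convL_apply, pairing_apply, convolution]
  refine integral_congr_ae ?_
  filter_upwards [coeFn_reflectL1 (translateL1 μ z g),
    (measurePreserving_invol μ).quasiMeasurePreserving.ae (coeFn_translateL1 z g)] with y hR hT
  rw [hR, hT, CommHypergroup.conv_comm]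

lemma translate_convL (x : K) (φ : Lp ℂ ∞ μ) (g : Lp ℂ 1 μ) :
    translate x (convL μ φ g) = convL μ φ (translateL1 μ x g) := by
  ext z
  rw [convL_apply, ← integral_translateL1_conv]
  exact (pairing μ φ ∘L reflectL1 μ).integral_comp_comm
    (integrable_conv_of_continuous (continuous_translateL1 g) x z)

lemma convL_translateLinfty (x : K) (φ : Lp ℂ ∞ μ) (g : Lp ℂ 1 μ) :
    convL μ (translateLinfty μ x φ) g = translate x (convL μ φ g) := by
  ext z
  rw [translate_convL, convL_apply, pairing_translateLinfty, translateL1_reflectL1, invol_invol,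
    translateL1_comm, convL_apply]

lemma convL_mem_UC (φ : Lp ℂ ∞ μ) (g : Lp ℂ 1 μ) : convL μ φ g ∈ UC K :=
  ((convL μ φ).continuous.comp (continuous_translateL1 g)).congr fun x =>
    (translate_convL x φ g).symm

/-- The operator `φ ↦ φ * g` from `L^∞(K)` to `UC(K)`. -/
def convUC (g : Lp ℂ 1 μ) : Lp ℂ ∞ μ →L[ℂ] UC K :=
  ((convL μ).flip g).codRestrict (UC K) fun φ => convL_mem_UC φ g

lemma convUC_apply (g : Lp ℂ 1 μ) (φ : Lp ℂ ∞ μ) (x : K) :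
    (convUC g φ : K →ᵇ ℂ) x = convolution μ φ g x :=
  (convolution_eq_convL φ g x).symm

lemma convUC_translateLinfty (g : Lp ℂ 1 μ) (x : K) (φ : Lp ℂ ∞ μ) :
    convUC g (translateLinfty μ x φ) = translateUC x (convUC g φ) :=
  Subtype.ext (convL_translateLinfty x φ g)

lemma continuous_convUC (φ : Lp ℂ ∞ μ) : Continuous fun g => convUC g φ :=
  (convL μ φ).continuous.subtype_mk _

lemma translateLinfty_toLinfty (x : K) (f : K →ᵇ ℂ) :
    translateLinfty μ x (toLinfty μ f) = toLinfty μ (translate x f) :=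
  Lp.ext ((translateLinfty_toLp μ x _).trans (MemLp.coeFn_toLp _).symm)

lemma convUC_toLinfty (f : UC K) {g : K →ᵇ ℂ} (hg : HasCompactSupport g) :
    convUC (toL1 μ hg) (toLinfty μ f) = average μ g f := by
  ext z
  calc convL μ (toLinfty μ f) (toL1 μ hg) z
      = pairing μ (toLinfty μ (translate z (f : K →ᵇ ℂ))) (reflectL1 μ (toL1 μ hg)) := by
        rw [convL_apply, ← translateLinfty_toLinfty, pairing_translateLinfty,
          translateL1_reflectL1, invol_invol]
    _ = ∫ y, translate z (f : K →ᵇ ℂ) y * reflect g y ∂μ := by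
        rw [reflectL1_toL1, pairing_toLinfty_toL1]
    _ = ∫ s, translate z (f : K →ᵇ ℂ) (invol s) * reflect g (invol s) ∂μ :=
        ((measurePreserving_invol μ).integral_comp (involHomeomorph K).measurableEmbedding _).symm
    _ = (average μ g f : K →ᵇ ℂ) z := by
        rw [average_apply hg]
        simp only [reflect_apply, invol_invol, translate_apply_comm z, mul_comm]

end Convolution

section AlphaMean

variable {K : Type*} [TopologicalSpace K] [MeasurableSpace K] [BorelSpace K]

lemma fourier_eq_pairing {μ : Measure K} (g : Lp ℂ 1 μ) (α : K →ᵇ ℂ) :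
    fourier μ g α = pairing μ (toLinfty μ (star α)) g :=
  (pairing_toLinfty (star α) g).symm

lemma IsAlphaMeanUC.map_average [CommHypergroup K] {μ : Measure K} [IsFiniteMeasureOnCompacts μ]
    {α : K →ᵇ ℂ} {hα : α ∈ Dual K} {m : UC K →L[ℂ] ℂ} (hm : IsAlphaMeanUC hα m) (f : UC K)
    {g : K →ᵇ ℂ} (hg : HasCompactSupport g) :
    m (average μ g f) = fourier μ (toL1 μ hg) α * m f := by
  rw [average, ← m.integral_comp_comm (integrable_smul_translateUC hg f), fourier_eq_pairing,
    pairing_toLinfty_toL1, ← integral_mul_const]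
  refine integral_congr_ae (.of_forall fun s => ?_)
  simp [hm.map_translate, hα.2.2, mul_assoc, mul_left_comm]

variable [T2Space K] [LocallyCompactSpace K]

open scoped ComplexOrder in
lemma exists_fourier_eq_one_of_ne_zero (μ : Measure K) [IsFiniteMeasureOnCompacts μ]
    [μ.IsOpenPosMeasure] {α : K →ᵇ ℂ} (hα : α ≠ 0) : ∃ g : Lp ℂ 1 μ, fourier μ g α = 1 := by
  obtain ⟨x, hx⟩ := DFunLike.ne_iff.1 hα
  obtain ⟨χ, hχc, hχ, hχ1, -⟩ := exists_boundedContinuous_one_zero_of_isCompact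
    (isCompact_singleton (x := x)) isOpen_univ (Set.subset_univ _)
  have hg : HasCompactSupport (χ * α) := hχc.mul_right
  have hαg : HasCompactSupport (star α * (χ * α)) := hg.mul_left
  have hc : 0 < ∫ y, (star α * (χ * α)) y ∂μ := by
    refine integral_pos_of_mem_support (t := x) (BoundedContinuousFunction.continuous _)
      (integrable_of_hasCompactSupport hαg) (fun y => ?_) (by simp [Measure.support_eq_univ]) ?_
    · exact (mul_nonneg (hχ y) (star_mul_self_nonneg (α y))).trans_eq (mul_left_comm _ _ _)
    · simpa [hχ1 rfl] using hx
  refine ⟨(∫ y, (star α * (χ * α)) y ∂μ)⁻¹ • toL1 μ hg, ?_⟩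
  rw [fourier_eq_pairing, map_smul, pairing_toLinfty_toL1]
  exact inv_mul_cancel₀ hc.ne'

variable [CommHypergroup K] {μ : Measure K} [IsHaar μ] {α : K →ᵇ ℂ}
  {hα : α ∈ Dual K} {m : UC K →L[ℂ] ℂ}

lemma IsAlphaMeanUC.map_convUC (hm : IsAlphaMeanUC hα m) (f : UC K) (g : Lp ℂ 1 μ) :
    m (convUC g (toLinfty μ f)) = fourier μ g α * m f := by
  refine L1_induction_hasCompactSupport (P := fun g => m (convUC g (toLinfty μ f)) =
    fourier μ g α * m f) ?_ (fun u hu => ?_) g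
  · simp only [fourier_eq_pairing]
    exact isClosed_eq (m.continuous.comp (continuous_convUC _))
      ((pairing μ _).continuous.mul continuous_const)
  · rw [convUC_toLinfty, hm.map_average]

lemma IsAlphaMeanUC.comp_convUC (hm : IsAlphaMeanUC hα m) {g : Lp ℂ 1 μ}
    (hg : fourier μ g α = 1) : IsAlphaMeanLinfty μ α (m ∘L convUC g) where
  map_char := (hm.map_convUC ⟨α, dual_subset_UC hα⟩ g).trans (by rw [hg, hm.map_char, one_mul])
  map_translate x φ := by
    simp only [ContinuousLinearMap.comp_apply, convUC_translateLinfty, hm.map_translate]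

lemma IsAlphaMeanLinfty.comp_toLinfty (hα : α ∈ Dual K) {M : Lp ℂ ∞ μ →L[ℂ] ℂ}
    (hM : IsAlphaMeanLinfty μ α M) :
    IsAlphaMeanUC hα (M ∘L toLinftyL μ ∘L (UC K).subtypeL) where
  map_char := hM.map_char
  map_translate x f :=
    (congrArg M (translateLinfty_toLinfty x (f : K →ᵇ ℂ)).symm).trans (hM.map_translate x _)

end AlphaMean

end

end Hypergroup

theorem mainTheorem2 {K : Type*} [TopologicalSpace K] [T2Space K] [LocallyCompactSpace K]
    [MeasurableSpace K] [BorelSpace K] [CommHypergroup K] (μ : Measure K) [Hypergroup.IsHaar μ]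
    (α : K →ᵇ ℂ) (hα : α ∈ Hypergroup.Dual K) :
    (Hypergroup.UCAmenable hα ↔ Hypergroup.Amenable μ α) ∧
    (∃ g : Lp ℂ 1 μ, Hypergroup.fourier μ g α = 1) ∧
    ∀ (m : Hypergroup.UC K →L[ℂ] ℂ), Hypergroup.IsAlphaMeanUC hα m →
      ∀ g : Lp ℂ 1 μ, Hypergroup.fourier μ g α = 1 →
        ∃ M : Lp ℂ ∞ μ →L[ℂ] ℂ, Hypergroup.IsAlphaMeanLinfty μ α M ∧
          (∀ φ : Lp ℂ ∞ μ, ∃ h : Hypergroup.UC K,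
            (∀ x, h.1 x = Hypergroup.convolution μ φ g x) ∧ M φ = m h) ∧
          ∀ f : Hypergroup.UC K, M (Hypergroup.toLinfty μ f.1) = m f := by
  obtain ⟨g₀, hg₀⟩ : ∃ g : Lp ℂ 1 μ, Hypergroup.fourier μ g α = 1 :=
    have := Hypergroup.isOpenPosMeasure_of_isHaar μ
    Hypergroup.exists_fourier_eq_one_of_ne_zero μ hα.1
  refine ⟨⟨?_, ?_⟩, ⟨g₀, hg₀⟩, fun m hm g hg => ⟨m ∘L Hypergroup.convUC g, hm.comp_convUC hg,
    fun φ => ⟨Hypergroup.convUC g φ, Hypergroup.convUC_apply g φ, rfl⟩, fun f => ?_⟩⟩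
  · rintro ⟨m, hm⟩
    exact ⟨_, hm.comp_convUC hg₀⟩
  · rintro ⟨M, hM⟩
    exact ⟨_, hM.comp_toLinfty hα⟩
  · exact (hm.map_convUC f g).trans (by rw [hg, one_mul])
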